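/- An entire function $E$ is of Hermite--Biehler class if $|E(\bar z)|<|E(z)|$ whenever $\operatorname{Im} z>0$. Write $E^*(z)=\overline{E(\bar z)}$. The de Branges space $\mathcal H(E)$ consists of the entire functions $f$ with $\|f\|_E^2=\int_{\mathbb R}|f(t)/E(t)|^2\,dt<\infty$ such that $f/E$ and $f^*/E$ are of bounded type (quotients of bounded analytic functions) and of nonpositive mean type $\limsup_{y\to+\infty}y^{-1}\log|\cdot(iy)|$ in the upper half-plane, with inner product $\langle f,g\rangle_E=\int_{\mathbb R}f(t)\overline{g(t)}|E(t)|^{-2}\,dt$. Its reproducing kernel is \[K_E(w,z)=\frac{\overline{E(w)}E(z)-E(\bar w)E^*(z)}{2\pi i(\bar w-z)},\] extended continuously to $z=\bar w$. A phase function of $E$ is a continuous, strictly increasing $\varphi_E:\mathbb R\to\mathbb R$ such that $E(x)e^{i\varphi_E(x)}\in\mathbb R$ for all $x\in\mathbb R$ (for instance, such that $E(x)=|E(x)|e^{-i\varphi_E(x)}$). A family $\{u_n\}$ in $\mathcal H(E)$ is a Parseval frame for $\mathcal H(E)$ if $\sum_n|\langle f,u_n\rangle_E|^2=\|f\|_E^2$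 for all $f\in\mathcal H(E)$. Theorem. Let $E,F$ be of Hermite--Biehler class, let $\varphi_{EF}$ be a phase function of $EF$, let $\alpha\in[0,\pi)$, let $J\subseteq\mathbb Z$ (for example $J=\mathbb Z$), and let $\{\lambda_n\}_{n\in J}\subset\mathbb R$ satisfy $\varphi_{EF}(\lambda_n)=n\pi+\alpha$ for all $n\in J$. Suppose that $\{K_{EF}(\lambda_n,\cdot)\}_{n\in J}$ is complete in $\mathcal H(EF)$, i.e. its linear span is dense. Then \[\left\{\frac{\overline{F(\lambda_n)}\,K_E(\lambda_n,\cdot)}{\sqrt{K_{EF}(\lambda_n,\lambda_n)}}\right\}_{n\in J}\] is a Parseval frame for $\mathcal H(E)$, and for every $f\in\mathcal H(E)$ \[f(z)=\sum_{n\in J}f(\lambda_n)\frac{|F(\lambda_n)|^2K_E(\lambda_n,z)}{K_{EF}(\lambda_n,\lambda_n)},\] where the series converges unconditionally in the norm of $\mathcal H(E)$ and at every $z\in\mathbb C$. Likewise \[\left\{\frac{E(\lambda_n)\,K_F(\lambda_n,\cdot)}{\sqrt{K_{EF}(\lambda_n,\lambda_n)}}\right\}_{n\in J}\] is a Parseval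 frame for $\mathcal H(F)$, and for every $g\in\mathcal H(F)$ \[g(z)=\sum_{n\in J}g(\lambda_n)\frac{|E(\lambda_n)|^2K_F(\lambda_n,z)}{K_{EF}(\lambda_n,\lambda_n)},\] with unconditional convergence in the norm of $\mathcal H(F)$ and at every $z\in\mathbb C$. -/

import Mathlib

open Complex MeasureTheory Filter Topology
open scoped ComplexConjugate

namespace DeBranges

noncomputable section

/-- The open upper half-plane, as a subset of `ℂ`. -/
def upperHalf : Set ℂ := {z | 0 < z.im}

/-- The Hermite-Biehler class: entire functions with `|E(z̄)| < |E(z)|` on the open upper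
half-plane. -/
structure IsHermiteBiehler (E : ℂ → ℂ) : Prop where
  entire : Differentiable ℂ E
  norm_lt : ∀ z ∈ upperHalf, ‖E (conj z)‖ < ‖E z‖

/-- `f*(z) = conj (f (z̄))`. -/
def starFn (f : ℂ → ℂ) (z : ℂ) : ℂ := conj (f (conj z))

/-- `f` is bounded and analytic in the open upper half-plane. -/
def IsBoundedAnalytic (f : ℂ → ℂ) : Prop :=
  DifferentiableOn ℂ f upperHalf ∧ ∃ C : ℝ, ∀ z ∈ upperHalf, ‖f z‖ ≤ C

/-- `f` is analytic and of bounded type in the open upper half-plane: it is the quotient `p / q`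
of two bounded analytic functions, where `q` is not identically zero. -/
def IsBoundedType (f : ℂ → ℂ) : Prop :=
  DifferentiableOn ℂ f upperHalf ∧
    ∃ p q : ℂ → ℂ, IsBoundedAnalytic p ∧ IsBoundedAnalytic q ∧
      (∃ z ∈ upperHalf, q z ≠ 0) ∧ ∀ z ∈ upperHalf, f z * q z = p z

/-- The mean type `limsup_{y → +∞} log |f(iy)| / y`, as an extended real (with `log 0 = -∞`). -/
def meanType (f : ℂ → ℂ) : EReal :=
  limsup (fun y : ℝ => ENNReal.log ‖f (I * (y : ℂ))‖ₑ / (y : EReal)) atTop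

/-- The de Branges space `H(E)`: the entire functions `f` with `∫ |f/E|² < ∞` on the real line,
such that `f/E` and `f*/E` are of bounded type and of nonpositive mean type in the upper
half-plane. -/
structure MemH (E f : ℂ → ℂ) : Prop where
  entire : Differentiable ℂ f
  sq_integrable : Integrable (fun t : ℝ => ‖f t / E t‖ ^ 2)
  boundedType : IsBoundedType (fun z => f z / E z)
  meanType_le : meanType (fun z => f z / E z) ≤ 0
  boundedType_star : IsBoundedType (fun z => starFn f z / E z)
  meanType_star_le : meanType (fun z => starFn f z / E z) ≤ 0

/-- The inner product of `H(E)`, linear in the first argument. -/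
def innerH (E f g : ℂ → ℂ) : ℂ := ∫ t : ℝ, f t * conj (g t) / ((‖E t‖ ^ 2 : ℝ) : ℂ)

/-- The norm of `H(E)`. -/
def normH (E f : ℂ → ℂ) : ℝ := Real.sqrt (∫ t : ℝ, ‖f t / E t‖ ^ 2)

/-- The reproducing kernel
`K_E(w, z) = (conj E(w) E(z) - E(w̄) E*(z)) / (2πi (w̄ - z))`. The numerator, as a function of `z`,
vanishes at `z = w̄`; there the value is the limit, i.e. minus the derivative of the numerator
divided by `2πi`. -/
def kernel (E : ℂ → ℂ) (w z : ℂ) : ℂ :=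
  if z = conj w then
    -deriv (fun ζ => conj (E w) * E ζ - E (conj w) * starFn E ζ) (conj w) / (2 * Real.pi * I)
  else
    (conj (E w) * E z - E (conj w) * starFn E z) / (2 * Real.pi * I * (conj w - z))

/-- `φ` is a phase function of `E`: continuous, strictly increasing, and `E(x) e^{iφ(x)}` is real
for every real `x`. In particular this holds if `E(x) = |E(x)| e^{-iφ(x)}`; asking only for a real
value also covers functions `E` with real zeros. -/
structure IsPhaseFunction (E : ℂ → ℂ) (φ : ℝ → ℝ) : Prop where
  continuous : Continuous φ
  strictMono : StrictMono φ
  real : ∀ x : ℝ, (E x * exp (I * φ x)).im = 0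

/-- The family `u` of elements of `H(E)` is complete in `H(E)`: every element of `H(E)` is
approximated in norm by finite linear combinations. -/
def IsCompleteIn {ι : Type*} (E : ℂ → ℂ) (u : ι → ℂ → ℂ) : Prop :=
  ∀ h, MemH E h → ∀ ε > 0, ∃ (s : Finset ι) (c : ι → ℂ),
    normH E (fun z => h z - ∑ n ∈ s, c n * u n z) < ε

/-- `u` is a Parseval frame for `H(E)`: a family in `H(E)` with
`∑ |⟨f, u n⟩|² = ‖f‖²` for all `f ∈ H(E)`. -/
def IsParsevalFrame {ι : Type*} (E : ℂ → ℂ) (u : ι → ℂ → ℂ) : Prop :=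
  (∀ n, MemH E (u n)) ∧
    ∀ f, MemH E f → HasSum (fun n => ‖innerH E f (u n)‖ ^ 2) (normH E f ^ 2)

/-- The series `∑ u n` converges unconditionally to `f`, both in the norm of `H(E)` and
pointwise on `ℂ`. -/
def IsExpansion {ι : Type*} (E f : ℂ → ℂ) (u : ι → ℂ → ℂ) : Prop :=
  Tendsto (fun s : Finset ι => normH E (fun z => f z - ∑ n ∈ s, u n z)) atTop (𝓝 0) ∧
    ∀ z, HasSum (fun n => u n z) (f z)

end

end DeBranges

/-! Multiplication by `F` is an isometry of `H(E)` into `H(EF)`, since the quotients `Ff / EF` and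
`f / E` agree almost everywhere on the real line. The phases of `EF` at the points `lam n` are
congruent modulo `π`, so the kernels of `H(EF)` at these points are orthogonal; completeness turns
them into an orthogonal basis up to zero vectors. The coefficient of `Ff` against the kernel at `lam
n` is `F(lam n) f(lam n)`, so Parseval's identity for `Ff` is the frame identity for `f`. The
orthogonal projection onto `F · H(E)` sends `K_EF(w, ·)` to `conj F(w) · F · K_E(w, ·)` for real
`w`, so the projection of the orthogonal expansion of `Ff` is `F` times the series claimed for `f`.
Norm convergence survives a projection, and pointwise convergence follows because evaluations are
bounded. The second half exchanges `E` and `F`.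

The analytic burden is the reproducing formula at real points (`MemH.innerH_kernel`), for a space
defined through bounded type and mean type. The quotient `f / E` is moved to the unit disc, where a
Poisson integral of `log⁺` plus a point mass at the image of infinity dominates its logarithm
(`norm_le_exp_poisson_add`). Nonpositive mean type removes the point mass by Phragmén-Lindelöf, and
Jensen's inequality gives the `H²` growth bound (`norm_sq_le_of_boundedType`). This bound justifies
Cauchy's formulas for `f / E` and `f* / E` (`MemH.cauchy`), and a symmetric regularization of the
singularity carries them to real points.

Real zeros of `E` are allowed: square integrability forces `f` to vanish there, so both sides of the
reproducing formula are zero. -/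

namespace DeBranges

noncomputable section

open Real (posLog)

/-! ### Orthogonal expansions in a Hilbert space. -/

/-- A vector in the closed linear span of an orthogonal family (zero vectors allowed) is the sum
of its orthogonal expansion. -/
theorem hasSum_orthogonal_expansion {ι V : Type*} [NormedAddCommGroup V] [InnerProductSpace ℂ V]
    (e : ι → V) (he : Pairwise fun i j => inner ℂ (e i) (e j) = 0) (x : V)
    (hx : ∀ ε > 0, ∃ (s : Finset ι) (c : ι → ℂ), ‖x - ∑ n ∈ s, c n • e n‖ < ε) :
    HasSum (fun n => (inner ℂ (e n) x / (‖e n‖ ^ 2 : ℝ)) • e n) x := by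
  classical
  set a : ι → ℂ := fun n => inner ℂ (e n) x / (‖e n‖ ^ 2 : ℝ) with ha
  have horth : ∀ (t : Finset ι), ∀ m ∈ t, inner ℂ (e m) (x - ∑ n ∈ t, a n • e n) = 0 := by
    intro t m hm
    rw [inner_sub_right, inner_sum, Finset.sum_eq_single m]
    · rw [inner_smul_right, ha]
      -- For a zero vector the coefficient is `0 / 0 = 0`, and the inner product vanishes anyway.
      rcases eq_or_ne (e m) 0 with h0 | h0
      · simp [h0]
      · rw [inner_self_eq_norm_sq_to_K]
        have : ((‖e m‖ : ℝ) : ℂ) ≠ 0 := by simpa using h0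
        push_cast
        simp only [coe_algebraMap]
        field_simp
        simp
    · intro b _ hb
      rw [inner_smul_right, he hb.symm, mul_zero]
    · exact fun h => absurd hm h
  rw [HasSum, SummationFilter.unconditional_filter, Metric.tendsto_atTop]
  intro ε hε
  obtain ⟨s, c, hc⟩ := hx ε hε
  refine ⟨s, fun t hst => ?_⟩
  rw [dist_comm, dist_eq_norm]
  refine lt_of_le_of_lt ?_ hc
  set y := x - ∑ n ∈ t, a n • e n with hy
  set z := ∑ n ∈ t, (a n - if n ∈ s then c n else 0) • e n with hz
  have hsplit : x - ∑ n ∈ s, c n • e n = y + z := by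
    have : ∑ n ∈ s, c n • e n = ∑ n ∈ t, (if n ∈ s then c n else 0) • e n := by
      rw [← Finset.sum_subset hst]
      · exact Finset.sum_congr rfl fun n hn => by simp [hn]
      · intro n _ hn
        simp [hn]
    rw [this, hy, hz]
    simp only [sub_smul, Finset.sum_sub_distrib]
    abel
  have hyz : inner ℂ y z = 0 := by
    rw [hz, inner_sum]
    refine Finset.sum_eq_zero fun n hn => ?_
    rw [inner_smul_right, ← inner_conj_symm, horth t n hn, map_zero, mul_zero]
  rw [hsplit]
  have := norm_add_sq_eq_norm_sq_add_norm_sq_of_inner_eq_zero y z hyz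
  nlinarith [norm_nonneg y, norm_nonneg z, norm_nonneg (y + z)]

/-! ### Poisson majorants of `log ‖g‖` in the disc. -/

/-- A continuous real function on a circle is uniformly approximated by real parts of entire
functions. -/
theorem exists_entire_re_approx {R : ℝ} (hR : 0 < R) {v : ℂ → ℝ}
    (hv : ContinuousOn v (Metric.sphere 0 R)) {δ : ℝ} (hδ : 0 < δ) :
    ∃ Q : ℂ → ℂ, Differentiable ℂ Q ∧ ∀ z ∈ Metric.sphere (0 : ℂ) R, |v z - (Q z).re| < δ := by
  have : Fact (0 < 2 * Real.pi) := ⟨Real.two_pi_pos⟩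
  let c : AddCircle (2 * Real.pi) → ℂ := fun x => R * (AddCircle.toCircle x : ℂ)
  have hc : Continuous c :=
    continuous_const.mul (continuous_subtype_val.comp AddCircle.continuous_toCircle)
  have hcs : ∀ x, c x ∈ Metric.sphere (0 : ℂ) R := fun x => by
    simp [c, abs_of_pos hR, Circle.norm_coe]
  let f : C(AddCircle (2 * Real.pi), ℂ) :=
    ⟨fun x => ((v (c x) : ℝ) : ℂ), continuous_ofReal.comp (hv.comp_continuous hc hcs)⟩
  have hdense : f ∈ (Submodule.span ℂ (Set.range
      (fourier (T := 2 * Real.pi)))).topologicalClosure := by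
    rw [span_fourier_closure_eq_top]
    trivial
  obtain ⟨T, hT, hfT⟩ := Metric.mem_closure_iff.1 hdense δ hδ
  -- Nonnegative frequencies extend to powers of `z`, negative ones to conjugates of powers. Since
  -- `Q₁ + conj Q₂` and `Q₁ + Q₂` have the same real part, the entire function `Q₁ + Q₂` does the
  -- job.
  have key : ∃ Q₁ Q₂ : ℂ → ℂ, Differentiable ℂ Q₁ ∧ Differentiable ℂ Q₂ ∧
      ∀ x, T x = Q₁ (c x) + conj (Q₂ (c x)) := by
    clear hfT
    induction hT using Submodule.span_induction with
    | mem T hT =>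
      obtain ⟨n, rfl⟩ := hT
      have hR0 : (R : ℂ) ≠ 0 := by exact_mod_cast hR.ne'
      have hpow : ∀ (m : ℕ) x, fourier (T := 2 * Real.pi) (m : ℤ) x = (c x / R) ^ m := by
        intro m x
        simp only [c, fourier_apply, natCast_zsmul, AddCircle.toCircle_nsmul, Circle.coe_pow]
        rw [mul_div_cancel_left₀ _ hR0]
      obtain ⟨m, rfl | rfl⟩ := n.eq_nat_or_neg
      · exact ⟨fun z => (z / R) ^ m, fun _ => 0, by fun_prop, by fun_prop,
          fun x => by simp [hpow m x, -fourier_apply]⟩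
      · exact ⟨fun _ => 0, fun z => (z / R) ^ m, by fun_prop, by fun_prop,
          fun x => by rw [fourier_neg, hpow m x]; simp⟩
    | zero => exact ⟨fun _ => 0, fun _ => 0, by fun_prop, by fun_prop, fun x => by simp⟩
    | add S T _ _ hS hT =>
      obtain ⟨A, B, hA, hB, h⟩ := hS
      obtain ⟨C, D, hC, hD, h'⟩ := hT
      exact ⟨fun z => A z + C z, fun z => B z + D z, by fun_prop, by fun_prop,
        fun x => by simp only [ContinuousMap.add_apply, h x, h' x, map_add]; ring⟩
    | smul a T _ hT =>
      obtain ⟨A, B, hA, hB, h⟩ := hT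
      exact ⟨fun z => a * A z, fun z => conj a * B z, by fun_prop, by fun_prop,
        fun x => by simp only [ContinuousMap.smul_apply, h x, map_mul, smul_eq_mul, conj_conj]
                    ring⟩
  obtain ⟨Q₁, Q₂, h₁, h₂, h⟩ := key
  refine ⟨fun z => Q₁ z + Q₂ z, by fun_prop, fun z hz => ?_⟩
  obtain ⟨x, rfl⟩ : ∃ x, c x = z := by
    refine ⟨((z.arg : ℝ) : AddCircle (2 * Real.pi)), ?_⟩
    have : ‖z‖ = R := by simpa using hz
    simp only [c, AddCircle.toCircle_apply_mk]
    conv_rhs => rw [← norm_mul_exp_arg_mul_I z, this]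
    rw [div_self Real.two_pi_pos.ne', one_mul, Circle.coe_exp]
  have h3 : dist (f x) (T x) < δ := lt_of_le_of_lt (ContinuousMap.dist_apply_le_dist x) hfT
  rw [dist_eq_norm] at h3
  refine lt_of_le_of_lt ?_ (lt_of_le_of_lt (abs_re_le_norm _) h3)
  rw [h x]
  simp [f]

/-- The real part of the Herglotz-Riesz kernel is continuous away from its pole. -/
theorem continuousOn_re_herglotzRieszKernel {R : ℝ} {w : ℂ} (hw : w ∈ Metric.ball (0 : ℂ) R) :
    ContinuousOn (re ∘ herglotzRieszKernel 0 w) (Metric.sphere 0 R) := by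
  have hR : 0 < R := Metric.pos_of_mem_ball hw
  have := continuousOn_herglotzRieszKernel_sphere hw
  rw [abs_of_pos hR] at this
  exact continuous_re.comp_continuousOn this

theorem re_herglotzRieszKernel_nonneg {R : ℝ} {w z : ℂ} (hw : w ∈ Metric.ball (0 : ℂ) R)
    (hz : z ∈ Metric.sphere (0 : ℂ) R) : 0 ≤ (herglotzRieszKernel 0 w z).re := by
  have := le_re_herglotzRieszKernel hz hw
  rw [herglotzRieszKernel_def]
  refine le_trans ?_ this
  have h : ‖w‖ < R := by simpa using hw
  rw [sub_zero]
  exact div_nonneg (by linarith) (by linarith [norm_nonneg w])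

theorem circleAverage_re_herglotzRieszKernel {R : ℝ} {w : ℂ} (hw : w ∈ Metric.ball (0 : ℂ) R) :
    Real.circleAverage (fun z => (herglotzRieszKernel 0 w z).re) 0 R = 1 := by
  have h : DiffContOnCl ℂ (fun _ : ℂ => (1 : ℂ)) (Metric.ball 0 R) := diffContOnCl_const
  have := h.circleAverage_re_herglotzRieszKernel_smul hw
  have h2 := congrArg re this
  have hR : 0 < R := Metric.pos_of_mem_ball hw
  rw [one_re] at h2
  rw [← h2, ← reCLM_apply, ← reCLM.circleAverage_comp_comm]
  · refine Real.circleAverage_congr_sphere fun z _ => ?_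
    simp
  · refine ContinuousOn.circleIntegrable hR.le ?_
    exact (continuousOn_re_herglotzRieszKernel hw).smul continuousOn_const

/-- The modulus of an analytic function is dominated by the exponential of the Poisson integral of
any continuous majorant of `log ‖g‖` on the circle. -/
theorem norm_le_exp_poisson {R : ℝ} {g : ℂ → ℂ} {v : ℂ → ℝ} {w : ℂ}
    (hg : DiffContOnCl ℂ g (Metric.ball 0 R)) (hv : ContinuousOn v (Metric.sphere 0 R))
    (hgv : ∀ z ∈ Metric.sphere (0 : ℂ) R, ‖g z‖ ≤ Real.exp (v z))
    (hw : w ∈ Metric.ball (0 : ℂ) R) :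
    ‖g w‖ ≤ Real.exp
      (Real.circleAverage (fun z => (herglotzRieszKernel 0 w z).re * v z) 0 R) := by
  have hR : 0 < R := Metric.pos_of_mem_ball hw
  set A := Real.circleAverage (fun z => (herglotzRieszKernel 0 w z).re * v z) 0 R with hA
  suffices h : ∀ δ > 0, ‖g w‖ ≤ Real.exp (A + 2 * δ) by
    have ht : Tendsto (fun δ : ℝ => Real.exp (A + 2 * δ)) (𝓝[>] 0) (𝓝 (Real.exp (A + 2 * 0))) :=
      (Continuous.tendsto (by fun_prop) 0).mono_left nhdsWithin_le_nhds
    rw [mul_zero, add_zero] at ht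
    exact ge_of_tendsto ht (eventually_nhdsWithin_of_forall fun δ hδ => h δ hδ)
  intro δ hδ
  obtain ⟨Q, hQ, hQv⟩ := exists_entire_re_approx hR hv hδ
  have hK := continuousOn_re_herglotzRieszKernel hw
  -- Maximum principle for `g * exp (-Q)`: on the circle `Re Q` is within `δ` of the majorant `v`.
  have hmax : ‖g w * exp (-Q w)‖ ≤ Real.exp δ := by
    refine Complex.norm_le_of_forall_mem_frontier_norm_le Metric.isBounded_ball
      (f := fun z => g z * exp (-Q z)) ?_ ?_ (subset_closure hw)
    · exact hg.smul (Differentiable.diffContOnCl (by fun_prop))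
    · intro z hz
      rw [frontier_ball _ hR.ne'] at hz
      have h1 := abs_lt.1 (hQv z hz)
      rw [norm_mul, norm_exp, neg_re]
      calc ‖g z‖ * Real.exp (-(Q z).re) ≤ Real.exp (v z) * Real.exp (-(Q z).re) := by
            gcongr
            exact hgv z hz
        _ ≤ Real.exp δ := by
            rw [← Real.exp_add]
            exact Real.exp_le_exp.2 (by linarith)
  -- The harmonic function `Re Q` is its own Poisson integral, and it is below `v + δ` on the
  -- circle. This costs the second `δ`.
  have hQw : (Q w).re ≤ A + δ := by
    have h1 : DiffContOnCl ℂ Q (Metric.ball 0 R) := hQ.diffContOnCl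
    have h2 := congrArg re (h1.circleAverage_re_herglotzRieszKernel_smul hw)
    have hint : CircleIntegrable ((re ∘ herglotzRieszKernel 0 w) • Q) 0 R :=
      ContinuousOn.circleIntegrable hR.le (hK.smul hQ.continuous.continuousOn)
    rw [← reCLM_apply, ← reCLM.circleAverage_comp_comm hint] at h2
    rw [← h2]
    have h3 : A + δ = Real.circleAverage (fun z => (herglotzRieszKernel 0 w z).re * v z +
        δ * (herglotzRieszKernel 0 w z).re) 0 R := by
      rw [Real.circleAverage_fun_add]
      · congr 1
        have := Real.circleAverage_fun_smul (a := δ) (c := 0) (R := R)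
          (f := fun z => (herglotzRieszKernel 0 w z).re)
        simp only [smul_eq_mul] at this
        rw [this, circleAverage_re_herglotzRieszKernel hw, mul_one]
      · exact ContinuousOn.circleIntegrable hR.le (hK.mul hv)
      · exact ContinuousOn.circleIntegrable hR.le (continuousOn_const.mul hK)
    rw [h3]
    refine Real.circleAverage_mono ?_ ?_ ?_
    · exact ContinuousOn.circleIntegrable hR.le
        (continuous_re.comp_continuousOn (hK.smul hQ.continuous.continuousOn))
    · exact ContinuousOn.circleIntegrable hR.le
        ((hK.mul hv).add (continuousOn_const.mul hK))
    · intro z hz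
      rw [abs_of_pos hR] at hz
      have h4 := abs_lt.1 (hQv z hz)
      have h5 := re_herglotzRieszKernel_nonneg hw hz
      simp only [Function.comp_apply, Pi.smul_apply', reCLM_apply, real_smul, re_ofReal_mul]
      nlinarith
  rw [norm_mul, norm_exp, neg_re, Real.exp_neg, mul_inv_le_iff₀ (Real.exp_pos _),
    ← Real.exp_add] at hmax
  exact hmax.trans (Real.exp_le_exp.2 (by linarith))

theorem le_exp_posLog {x : ℝ} (hx : 0 ≤ x) : x ≤ Real.exp (posLog x) := by
  rw [Real.posLog_eq_log_max_one hx, Real.exp_log (lt_max_of_lt_left one_pos)]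
  exact le_max_right _ _

/-- The circle averages of `log⁺ ‖g‖` of a quotient `g = p / q` of functions bounded by `1` are
bounded by `-log ‖q 0‖`. -/
theorem circleAverage_posLog_norm_le {g p q : ℂ → ℂ} (hg : DifferentiableOn ℂ g (Metric.ball 0 1))
    (hq : DifferentiableOn ℂ q (Metric.ball 0 1)) (hp1 : ∀ z ∈ Metric.ball (0 : ℂ) 1, ‖p z‖ ≤ 1)
    (hq1 : ∀ z ∈ Metric.ball (0 : ℂ) 1, ‖q z‖ ≤ 1)
    (hgq : ∀ z ∈ Metric.ball (0 : ℂ) 1, g z * q z = p z) (hq0 : q 0 ≠ 0)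
    {r : ℝ} (hr0 : 0 < r) (hr1 : r < 1) :
    Real.circleAverage (fun z => posLog ‖g z‖) 0 r ≤ -Real.log ‖q 0‖ := by
  have hsub : Metric.closedBall (0 : ℂ) r ⊆ Metric.ball 0 1 := Metric.closedBall_subset_ball hr1
  have hsph : Metric.sphere (0 : ℂ) r ⊆ Metric.ball 0 1 :=
    Metric.sphere_subset_closedBall.trans hsub
  have hu : ContinuousOn (fun z => posLog ‖g z‖) (Metric.sphere 0 r) :=
    Real.continuous_posLog.comp_continuousOn (hg.continuousOn.mono hsph).norm
  obtain ⟨A, hA⟩ := (isCompact_sphere (0 : ℂ) r).bddAbove_image hu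
  have hA' : ∀ z ∈ Metric.sphere (0 : ℂ) r, posLog ‖g z‖ ≤ A :=
    fun z hz => hA (Set.mem_image_of_mem _ hz)
  -- Zeros of `q` make `log ‖q‖` discontinuous, hence the truncation. Where it is active, `-v = A`
  -- already bounds `log⁺ ‖g‖`; elsewhere `‖g q‖ ≤ 1` and `‖q‖ ≤ 1` give `log⁺ ‖g‖ ≤ -log ‖q‖ = -v`.
  set v : ℂ → ℝ := fun z => Real.log (max ‖q z‖ (Real.exp (-A))) with hv
  have hpos : ∀ z, 0 < max ‖q z‖ (Real.exp (-A)) := fun z => lt_max_of_lt_right (Real.exp_pos _)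
  have hvc : ContinuousOn v (Metric.sphere 0 r) :=
    ContinuousOn.log ((hq.continuousOn.mono hsph).norm.sup continuousOn_const)
      fun z _ => (hpos z).ne'
  have h1 := norm_le_exp_poisson (g := q) (v := v) (w := 0) (R := r)
    ((hq.mono (by rwa [closure_ball _ hr0.ne'])).diffContOnCl) hvc
    (fun z _ => by rw [hv, Real.exp_log (hpos z)]; exact le_max_left _ _)
    (Metric.mem_ball_self hr0)
  have h2 : Real.circleAverage (fun z => (herglotzRieszKernel 0 0 z).re * v z) 0 r =
      Real.circleAverage v 0 r := by
    refine Real.circleAverage_congr_sphere fun z hz => ?_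
    have hz0 : z ≠ 0 := by
      rintro rfl
      simp at hz
      exact hr0.ne (by rwa [abs_of_pos hr0] at hz)
    simp [herglotzRieszKernel_def, div_self hz0]
  rw [h2, ← Real.log_le_iff_le_exp (norm_pos_iff.2 hq0)] at h1
  have h3 : Real.circleAverage (fun z => posLog ‖g z‖) 0 r ≤
      Real.circleAverage (fun z => (-1 : ℝ) • v z) 0 r := by
    refine Real.circleAverage_mono (hu.circleIntegrable hr0.le)
      ((hvc.const_smul (-1 : ℝ)).circleIntegrable hr0.le) fun z hz => ?_
    rw [abs_of_pos hr0] at hz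
    have hzb := hsph hz
    simp only [smul_eq_mul, neg_one_mul, hv]
    rcases le_total ‖q z‖ (Real.exp (-A)) with h | h
    · rw [max_eq_right h, Real.log_exp, neg_neg]
      exact hA' z hz
    · rw [max_eq_left h]
      have hqz : 0 < ‖q z‖ := (Real.exp_pos _).trans_le h
      have hl : Real.log ‖q z‖ ≤ 0 := Real.log_nonpos hqz.le (hq1 z hzb)
      rw [Real.posLog_apply]
      refine max_le (by linarith) ?_
      rcases eq_or_ne (g z) 0 with h0 | h0
      · simp only [h0, norm_zero, Real.log_zero]
        linarith
      · have h4 : Real.log (‖g z‖ * ‖q z‖) ≤ 0 := by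
          rw [← norm_mul, hgq z hzb]
          exact Real.log_nonpos (norm_nonneg _) (hp1 z hzb)
        rw [Real.log_mul (norm_ne_zero_iff.2 h0) hqz.ne'] at h4
        linarith
  rw [Real.circleAverage_fun_smul, smul_eq_mul] at h3
  linarith

/-- A quotient of bounded functions in the unit disc, continuous up to the boundary except at `1`,
is dominated by the Poisson integral of `log⁺` of its boundary values and a point mass at `1`. -/
theorem norm_le_exp_poisson_add {g p q : ℂ → ℂ} (hg : DifferentiableOn ℂ g (Metric.ball 0 1))
    (hgc : ContinuousOn g (Metric.closedBall 0 1 \ {1}))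
    (hq : DifferentiableOn ℂ q (Metric.ball 0 1)) (hp1 : ∀ z ∈ Metric.ball (0 : ℂ) 1, ‖p z‖ ≤ 1)
    (hq1 : ∀ z ∈ Metric.ball (0 : ℂ) 1, ‖q z‖ ≤ 1)
    (hgq : ∀ z ∈ Metric.ball (0 : ℂ) 1, g z * q z = p z) (hq0 : q 0 ≠ 0)
    (hint : CircleIntegrable (fun z => posLog ‖g z‖) 0 1) {w : ℂ} (hw : w ∈ Metric.ball (0 : ℂ) 1) :
    ‖g w‖ ≤ Real.exp
      (Real.circleAverage (fun z => (herglotzRieszKernel 0 w z).re * posLog ‖g z‖) 0 1 +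
        (herglotzRieszKernel 0 w 1).re * (-Real.log ‖q 0‖)) := by
  set K : ℂ → ℝ := fun z => (herglotzRieszKernel 0 w z).re with hK
  set u : ℂ → ℝ := fun z => posLog ‖g z‖ with hu
  set C := -Real.log ‖q 0‖ with hC
  have hw1 : ‖w‖ < 1 := by simpa using hw
  have hKc : ∀ z, z ≠ w → ContinuousAt K z := fun z hz => by
    have : z - w ≠ 0 := sub_ne_zero.2 hz
    simp only [hK, herglotzRieszKernel_def, sub_zero]
    exact continuous_re.continuousAt.comp (ContinuousAt.div (by fun_prop) (by fun_prop) this)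
  have hu0 : ∀ z, 0 ≤ u z := fun z => Real.posLog_nonneg
  have huc : ContinuousOn u (Metric.closedBall 0 1 \ {1}) :=
    Real.continuous_posLog.comp_continuousOn hgc.norm
  have hKu1 : CircleIntegrable (fun z => K z * u z) 0 1 := by
    have := hint.continuousOn_smul (g := K) (by
      rw [abs_one]
      exact continuousOn_re_herglotzRieszKernel hw)
    exact this
  suffices h : ∀ ε > 0, ‖g w‖ ≤
      Real.exp (Real.circleAverage (fun z => K z * u z) 0 1 + (K 1 + ε) * C) by
    have ht : Tendsto (fun ε : ℝ => Real.exp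
        (Real.circleAverage (fun z => K z * u z) 0 1 + (K 1 + ε) * C)) (𝓝[>] 0)
        (𝓝 (Real.exp (Real.circleAverage (fun z => K z * u z) 0 1 + (K 1 + 0) * C))) :=
      (Continuous.tendsto (by fun_prop) 0).mono_left nhdsWithin_le_nhds
    rw [add_zero] at ht
    exact ge_of_tendsto ht (eventually_nhdsWithin_of_forall fun δ hδ => h δ hδ)
  intro ε hε
  -- On smaller circles `K u ≤ h + (K 1 + ε) u`. The first term vanishes near the bad point `1`, so
  -- its averages converge as `r → 1`; the averages of `u` are at most `C`, which produces the point
  -- mass. The kernel `K` does not depend on the radius.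
  set h : ℂ → ℝ := fun z => max (K z - (K 1 + ε)) 0 * u z with hh
  have hw1' : (1 : ℂ) ≠ w := by
    rintro rfl
    simp at hw1
  have hhc : ContinuousOn h {z : ℂ | ‖z - 0‖ ∈ Set.Ioc ‖w‖ 1} := by
    intro z hz
    simp only [sub_zero, Set.mem_ofPred_eq, Set.mem_Ioc] at hz
    have hzw : z ≠ w := by
      rintro rfl
      exact lt_irrefl _ hz.1
    rcases eq_or_ne z 1 with rfl | hz1
    · have h0 : h =ᶠ[𝓝 1] fun _ => 0 := by
        have : ∀ᶠ z in 𝓝 (1 : ℂ), K z < K 1 + ε :=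
          (hKc 1 hzw).eventually_lt_const (by linarith)
        filter_upwards [this] with z hz
        rw [hh]
        simp only
        rw [max_eq_right (by linarith), zero_mul]
      exact (continuousAt_const.congr h0.symm).continuousWithinAt
    · refine ContinuousWithinAt.mul ?_ ?_
      · exact (((hKc z hzw).sub continuousAt_const).sup continuousAt_const).continuousWithinAt
      · have h1 : ContinuousWithinAt u (Metric.closedBall 0 1 \ {1}) z :=
          huc z ⟨by simpa using hz.2, hz1⟩
        refine h1.mono_of_mem_nhdsWithin ?_
        rw [mem_nhdsWithin]
        refine ⟨{1}ᶜ, isOpen_compl_singleton, hz1, ?_⟩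
        rintro y ⟨hy1, hy2⟩
        simp only [sub_zero, Set.mem_ofPred_eq, Set.mem_Ioc] at hy2
        exact ⟨by simpa using hy2.2, hy1⟩
  have hlim : Tendsto (Real.circleAverage h 0) (𝓝[<] 1) (𝓝 (Real.circleAverage h 0 1)) := by
    have := (Real.ContinuousOn.circleAverage hhc fun r hr => (norm_nonneg w).trans hr.1.le) 1
      ⟨hw1, le_rfl⟩
    refine this.mono_left ?_
    rw [← nhdsWithin_Ioo_eq_nhdsLT hw1]
    exact nhdsWithin_mono _ Set.Ioo_subset_Ioc_self
  have hstep : ∀ᶠ r in 𝓝[<] (1 : ℝ),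
      ‖g w‖ ≤ Real.exp (Real.circleAverage h 0 r + (K 1 + ε) * C) := by
    filter_upwards [Ioo_mem_nhdsLT hw1] with r hr
    have hr0 : 0 < r := (norm_nonneg w).trans_lt hr.1
    have hsub : Metric.closedBall (0 : ℂ) r ⊆ Metric.ball 0 1 :=
      Metric.closedBall_subset_ball hr.2
    have hsph : Metric.sphere (0 : ℂ) r ⊆ Metric.ball 0 1 :=
      Metric.sphere_subset_closedBall.trans hsub
    have hus : ContinuousOn u (Metric.sphere 0 r) :=
      Real.continuous_posLog.comp_continuousOn (hg.continuousOn.mono hsph).norm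
    have hwr : w ∈ Metric.ball (0 : ℂ) r := by simpa using hr.1
    have hKs : ContinuousOn K (Metric.sphere 0 r) := continuousOn_re_herglotzRieszKernel hwr
    have h1 := norm_le_exp_poisson (g := g) (v := u)
      ((hg.mono (by rwa [closure_ball _ hr0.ne'])).diffContOnCl) hus
      (fun z _ => le_exp_posLog (norm_nonneg _)) hwr
    refine h1.trans (Real.exp_le_exp.2 ?_)
    have h2 : Real.circleAverage (fun z => h z + (K 1 + ε) • u z) 0 r ≤
        Real.circleAverage h 0 r + (K 1 + ε) * C := by
      rw [Real.circleAverage_fun_add, Real.circleAverage_fun_smul, smul_eq_mul]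
      · have h3 := circleAverage_posLog_norm_le hg hq hp1 hq1 hgq hq0 hr0 hr.2
        have h4 : 0 ≤ K 1 := re_herglotzRieszKernel_nonneg hw (by simp)
        gcongr
      · exact ContinuousOn.circleIntegrable hr0.le
          (((hKs.sub continuousOn_const).sup continuousOn_const).mul hus)
      · exact ContinuousOn.circleIntegrable hr0.le (hus.const_smul (K 1 + ε))
    refine le_trans ?_ h2
    refine Real.circleAverage_mono ((hKs.mul hus).circleIntegrable hr0.le) ?_ fun z _ => ?_
    · exact ContinuousOn.circleIntegrable hr0.le
          ((((hKs.sub continuousOn_const).sup continuousOn_const).mul hus).add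
            (hus.const_smul (K 1 + ε)))
    · have h5 := le_max_left (K z - (K 1 + ε)) 0
      have h6 := hu0 z
      simp only [hh, smul_eq_mul]
      nlinarith
  have h7 : ‖g w‖ ≤ Real.exp (Real.circleAverage h 0 1 + (K 1 + ε) * C) :=
    ge_of_tendsto ((Real.continuous_exp.tendsto _).comp (hlim.add_const _)) hstep
  refine h7.trans (Real.exp_le_exp.2 (add_le_add ?_ le_rfl))
  have hK1 : ContinuousOn K (Metric.sphere 0 1) := continuousOn_re_herglotzRieszKernel hw
  refine Real.circleAverage_mono ?_ hKu1 fun z hz => ?_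
  · have := hint.continuousOn_smul (g := fun z => max (K z - (K 1 + ε)) 0) (by
      rw [abs_one]
      exact (hK1.sub continuousOn_const).sup continuousOn_const)
    exact this
  · rw [abs_one] at hz
    have h8 : 0 ≤ K z := re_herglotzRieszKernel_nonneg hw hz
    have h9 : 0 ≤ K 1 := re_herglotzRieszKernel_nonneg hw (by simp)
    have h10 := hu0 z
    simp only [hh]
    gcongr
    exact max_le (by linarith) h8

/-! ### The Cayley transform and its boundary change of variables. -/

/-- The Cayley transform of the upper half-plane onto the unit disc sending `a` to `0`. -/
def toDisc (a z : ℂ) : ℂ := (z - a) / (z - conj a)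

/-- The inverse of `toDisc a`. -/
def ofDisc (a ζ : ℂ) : ℂ := (a - conj a * ζ) / (1 - ζ)

theorem sub_conj_ne_zero {a z : ℂ} (ha : 0 < a.im) (hz : 0 ≤ z.im) : z - conj a ≠ 0 := by
  intro h
  have := congrArg im h
  simp at this
  linarith

theorem self_sub_conj_ne_zero {a : ℂ} (ha : 0 < a.im) : a - conj a ≠ 0 :=
  sub_conj_ne_zero ha ha.le

theorem ofDisc_toDisc {a z : ℂ} (ha : 0 < a.im) (hz : 0 ≤ z.im) : ofDisc a (toDisc a z) = z := by
  have h1 := sub_conj_ne_zero ha hz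
  have h2 := self_sub_conj_ne_zero ha
  have h3 : 1 - toDisc a z = (a - conj a) / (z - conj a) := by
    rw [toDisc]
    field_simp
    ring
  have h4 : a - conj a * toDisc a z = z * ((a - conj a) / (z - conj a)) := by
    rw [toDisc]
    field_simp
    ring
  rw [ofDisc, h3, h4, mul_div_assoc, div_self (div_ne_zero h2 h1), mul_one]

theorem ofDisc_injOn {a : ℂ} (ha : 0 < a.im) : Set.InjOn (ofDisc a) {1}ᶜ := by
  intro x hx y hy h
  have h1 : 1 - x ≠ 0 := sub_ne_zero.2 (Ne.symm hx)
  have h2 : 1 - y ≠ 0 := sub_ne_zero.2 (Ne.symm hy)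
  rw [ofDisc, ofDisc, div_eq_div_iff h1 h2] at h
  have h3 : (a - conj a) * (x - y) = 0 := by linear_combination h
  exact sub_eq_zero.1 ((mul_eq_zero.1 h3).resolve_left (self_sub_conj_ne_zero ha))

theorem im_ofDisc (a ζ : ℂ) :
    (ofDisc a ζ).im = a.im * (1 - ‖ζ‖ ^ 2) / ‖1 - ζ‖ ^ 2 := by
  rw [ofDisc, div_im, ← normSq_eq_norm_sq, ← normSq_eq_norm_sq, ← sub_div, normSq_apply ζ]
  congr 1
  simp
  ring

theorem norm_toDisc_sq {a z : ℂ} (ha : 0 < a.im) (hz : 0 ≤ z.im) :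
    1 - ‖toDisc a z‖ ^ 2 = 4 * z.im * a.im / ‖z - conj a‖ ^ 2 := by
  have h1 : ‖z - conj a‖ ≠ 0 := norm_ne_zero_iff.2 (sub_conj_ne_zero ha hz)
  rw [toDisc, norm_div, div_pow, eq_div_iff (pow_ne_zero 2 h1), sub_mul,
    div_mul_cancel₀ _ (pow_ne_zero 2 h1), one_mul, ← normSq_eq_norm_sq, ← normSq_eq_norm_sq,
    normSq_apply, normSq_apply]
  simp
  ring

theorem toDisc_mem_ball {a z : ℂ} (ha : 0 < a.im) (hz : 0 < z.im) :
    toDisc a z ∈ Metric.ball (0 : ℂ) 1 := by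
  have h := norm_toDisc_sq ha hz.le
  have h1 : 0 < ‖z - conj a‖ := norm_pos_iff.2 (sub_conj_ne_zero ha hz.le)
  have h2 : 0 < 4 * z.im * a.im / ‖z - conj a‖ ^ 2 := by positivity
  rw [mem_ball_zero_iff]
  nlinarith [norm_nonneg (toDisc a z)]

theorem im_ofDisc_pos {a ζ : ℂ} (ha : 0 < a.im) (hζ : ζ ∈ Metric.ball (0 : ℂ) 1) :
    0 < (ofDisc a ζ).im := by
  rw [mem_ball_zero_iff] at hζ
  have h1 : 0 < ‖1 - ζ‖ := by
    rw [norm_pos_iff, sub_ne_zero]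
    rintro rfl
    simp at hζ
  have h2 : 0 < 1 - ‖ζ‖ ^ 2 := by nlinarith [norm_nonneg ζ]
  rw [im_ofDisc]
  positivity

theorem im_ofDisc_nonneg {a ζ : ℂ} (ha : 0 < a.im) (hζ : ζ ∈ Metric.closedBall (0 : ℂ) 1) :
    0 ≤ (ofDisc a ζ).im := by
  rw [mem_closedBall_zero_iff] at hζ
  have h2 : 0 ≤ 1 - ‖ζ‖ ^ 2 := by nlinarith [norm_nonneg ζ]
  rw [im_ofDisc]
  positivity

theorem differentiableAt_ofDisc {a ζ : ℂ} (hζ : ζ ≠ 1) : DifferentiableAt ℂ (ofDisc a) ζ := by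
  have : 1 - ζ ≠ 0 := sub_ne_zero.2 (Ne.symm hζ)
  unfold ofDisc
  fun_prop (disch := assumption)

theorem one_sub_toDisc {a z : ℂ} (ha : 0 < a.im) (hz : 0 ≤ z.im) :
    1 - toDisc a z = (a - conj a) / (z - conj a) := by
  have h1 := sub_conj_ne_zero ha hz
  rw [toDisc]
  field_simp
  ring

theorem norm_self_sub_conj {a : ℂ} (ha : 0 < a.im) : ‖a - conj a‖ = 2 * a.im := by
  rw [Complex.sub_conj]
  simp [abs_of_pos ha]

/-- The boundary point `1` corresponds to infinity, so a point mass there becomes the growth factor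
`exp (c * im z)` in the half-plane. -/
theorem re_herglotzRieszKernel_toDisc_one {a z : ℂ} (ha : 0 < a.im) (hz : 0 < z.im) :
    (herglotzRieszKernel 0 (toDisc a z) 1).re = z.im / a.im := by
  have h1 : ‖z - conj a‖ ≠ 0 := norm_ne_zero_iff.2 (sub_conj_ne_zero ha hz.le)
  have h := congrFun (poissonKernel_eq_re_herglotzRieszKernel (c := 0) (w := toDisc a z)) 1
  rw [Function.comp_apply] at h
  rw [← h, poissonKernel_def]
  simp only [sub_zero, norm_one, one_pow]
  rw [norm_toDisc_sq ha hz.le, one_sub_toDisc ha hz.le, norm_div, norm_self_sub_conj ha]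
  field_simp
  norm_num

/-- In the half-plane the kernel is `2 * im z / |t - z|²` times the Jacobian `dt/dθ`, the last
factor on the right. Only `|t - z| ≥ im z` is used, which is what the growth bound needs. -/
theorem re_herglotzRieszKernel_toDisc_le {a z : ℂ} (ha : 0 < a.im) (hz : 0 < z.im) (t : ℝ) :
    (herglotzRieszKernel 0 (toDisc a z) (toDisc a t)).re ≤
      2 / z.im * (2 * a.im / ‖1 - toDisc a t‖ ^ 2) := by
  have hz1 := sub_conj_ne_zero ha hz.le
  have ht0 : (0 : ℝ) ≤ (t : ℂ).im := by simp
  have ht1 := sub_conj_ne_zero ha ht0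
  have h1 : ‖z - conj a‖ ≠ 0 := norm_ne_zero_iff.2 hz1
  have h2 : ‖(t : ℂ) - conj a‖ ≠ 0 := norm_ne_zero_iff.2 ht1
  have h := congrFun (poissonKernel_eq_re_herglotzRieszKernel (c := 0) (w := toDisc a z))
    (toDisc a t)
  rw [Function.comp_apply] at h
  have ht : 1 - ‖toDisc a t‖ ^ 2 = 0 := by
    rw [norm_toDisc_sq ha ht0]
    simp
  have hd : toDisc a t - toDisc a z = (a - conj a) * (t - z) / ((t - conj a) * (z - conj a)) := by
    rw [toDisc, toDisc]
    field_simp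
    ring
  have htz : z.im ≤ ‖(t : ℂ) - z‖ := by
    have := abs_im_le_norm ((t : ℂ) - z)
    simp only [sub_im, ofReal_im, zero_sub, abs_neg] at this
    exact (le_abs_self _).trans this
  have htz0 : 0 < ‖(t : ℂ) - z‖ := hz.trans_le htz
  rw [← h, poissonKernel_def]
  simp only [sub_zero]
  rw [show ‖toDisc a t‖ ^ 2 = 1 by linarith, norm_toDisc_sq ha hz.le, one_sub_toDisc ha ht0, hd,
    norm_div, norm_div, norm_mul, norm_mul, norm_self_sub_conj ha]
  have e1 : 4 * z.im * a.im / ‖z - conj a‖ ^ 2 /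
      (2 * a.im * ‖(t : ℂ) - z‖ / (‖(t : ℂ) - conj a‖ * ‖z - conj a‖)) ^ 2 =
      ‖(t : ℂ) - conj a‖ ^ 2 / a.im * (z.im / ‖(t : ℂ) - z‖ ^ 2) := by
    field_simp
    norm_num
  have e2 : 2 / z.im * (2 * a.im / (2 * a.im / ‖(t : ℂ) - conj a‖) ^ 2) =
      ‖(t : ℂ) - conj a‖ ^ 2 / a.im * (1 / z.im) := by
    field_simp
  rw [e1, e2]
  gcongr ?_ * ?_
  rw [div_le_div_iff₀ (by positivity) hz]
  nlinarith

/-- The boundary correspondence of `ofDisc`, in the angular coordinate. -/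
def angleToReal (a : ℂ) (θ : ℝ) : ℝ := (ofDisc a (circleMap 0 1 θ)).re

theorem circleMap_ne_one {θ : ℝ} (hθ : θ ∈ Set.Ioo 0 (2 * Real.pi)) : circleMap 0 1 θ ≠ 1 := by
  intro h
  rw [circleMap_zero, ofReal_one, one_mul, Complex.exp_eq_one_iff] at h
  obtain ⟨n, hn⟩ := h
  have h1 : θ = n * (2 * Real.pi) := by
    have := congrArg im hn
    simpa using this
  have hpi := Real.pi_pos
  have h2 : (0 : ℝ) < n := by
    by_contra hc
    nlinarith [hθ.1]
  have h3 : (n : ℝ) < 1 := by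
    by_contra hc
    nlinarith [hθ.2]
  have h4 : (0 : ℤ) < n := by exact_mod_cast h2
  have h5 : n < (1 : ℤ) := by exact_mod_cast h3
  omega

theorem ofDisc_circleMap (a : ℂ) (θ : ℝ) :
    ofDisc a (circleMap 0 1 θ) = (angleToReal a θ : ℂ) := by
  apply Complex.ext
  · simp [angleToReal]
  · rw [im_ofDisc]
    simp

theorem toDisc_angleToReal {a : ℂ} (ha : 0 < a.im) {θ : ℝ} (hθ : θ ∈ Set.Ioo 0 (2 * Real.pi)) :
    toDisc a (angleToReal a θ) = circleMap 0 1 θ := by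
  have h0 : (0 : ℝ) ≤ (angleToReal a θ : ℂ).im := by simp
  have h1 : toDisc a (angleToReal a θ) ≠ 1 := by
    intro h
    have := one_sub_toDisc ha h0
    rw [h, sub_self] at this
    exact div_ne_zero (self_sub_conj_ne_zero ha) (sub_conj_ne_zero ha h0) this.symm
  refine ofDisc_injOn ha h1 (circleMap_ne_one hθ) ?_
  rw [ofDisc_toDisc ha h0, ofDisc_circleMap]

theorem hasDerivAt_angleToReal (a : ℂ) {θ : ℝ} (hθ : θ ∈ Set.Ioo 0 (2 * Real.pi)) :
    HasDerivAt (angleToReal a) (2 * a.im / ‖1 - circleMap 0 1 θ‖ ^ 2) θ := by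
  set ζ := circleMap 0 1 θ with hζ
  have h1 : 1 - ζ ≠ 0 := sub_ne_zero.2 (circleMap_ne_one hθ).symm
  have hn : ‖ζ‖ = 1 := by simp [hζ]
  have hd : HasDerivAt (ofDisc a) ((a - conj a) / (1 - ζ) ^ 2) ζ := by
    have := ((hasDerivAt_const ζ a).sub ((hasDerivAt_id ζ).const_mul (conj a))).div
      ((hasDerivAt_const ζ (1 : ℂ)).sub (hasDerivAt_id ζ)) h1
    refine this.congr_deriv ?_
    simp only [id_eq, Pi.sub_apply]
    congr 1
    ring
  have hc := hd.comp_of_eq θ (hasDerivAt_circleMap 0 1 θ) rfl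
  have hr := reCLM.hasFDerivAt.comp_hasDerivAt θ hc
  refine hr.congr_deriv ?_
  have hζζ : ζ * conj ζ = 1 := by rw [mul_conj', hn]; simp
  have h2 : 1 - conj ζ ≠ 0 := by
    have := (map_ne_zero (starRingEnd ℂ)).2 h1
    simpa using this
  -- On the unit circle `(1 - ζ)² = -ζ |1 - ζ|²`, so the derivative along the circle is real and
  -- positive when `im a > 0`.
  have hcast : (a - conj a) / (1 - ζ) ^ 2 * (ζ * I) =
      ((2 * a.im / ‖1 - ζ‖ ^ 2 : ℝ) : ℂ) := by
    push_cast
    rw [← mul_conj' (1 - ζ), Complex.sub_conj, map_sub, map_one,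
      div_mul_eq_mul_div, div_eq_div_iff (pow_ne_zero 2 h1) (mul_ne_zero h1 h2)]
    push_cast
    linear_combination (2 * a.im * ζ * (1 - ζ) * (1 - conj ζ)) * I_mul_I +
      (2 * a.im * (1 - ζ)) * hζζ
  rw [hcast, reCLM_apply, ofReal_re]

theorem angleToReal_injOn {a : ℂ} (ha : 0 < a.im) :
    Set.InjOn (angleToReal a) (Set.Ioo 0 (2 * Real.pi)) := by
  intro x hx y hy h
  have h1 : circleMap 0 1 x = circleMap 0 1 y := by
    rw [← toDisc_angleToReal ha hx, ← toDisc_angleToReal ha hy, h]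
  exact injOn_circleMap_of_abs_sub_le' one_ne_zero (by linarith)
    ⟨hx.1.le, hx.2⟩ ⟨hy.1.le, hy.2⟩ h1

theorem angleToReal_image {a : ℂ} (ha : 0 < a.im) :
    angleToReal a '' Set.Ioo 0 (2 * Real.pi) = Set.univ := by
  refine Set.eq_univ_of_forall fun t => ?_
  have h0 : (0 : ℝ) ≤ (t : ℂ).im := by simp
  have hn : ‖toDisc a t‖ = 1 := by
    have h := norm_toDisc_sq ha h0
    simp only [ofReal_im, mul_zero, zero_mul, zero_div] at h
    nlinarith [norm_nonneg (toDisc a t)]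
  have h1 : toDisc a t ≠ 1 := by
    intro h
    have := one_sub_toDisc ha h0
    rw [h, sub_self] at this
    exact div_ne_zero (self_sub_conj_ne_zero ha) (sub_conj_ne_zero ha h0) this.symm
  have h2 : circleMap 0 1 (toDisc a t).arg = toDisc a t := by
    rw [circleMap_zero, ofReal_one, one_mul]
    conv_rhs => rw [← norm_mul_exp_arg_mul_I (toDisc a t), hn, ofReal_one, one_mul]
  have hpi := Real.pi_pos
  obtain ⟨θ, hθ, hθ'⟩ : ∃ θ ∈ Set.Ioo 0 (2 * Real.pi), circleMap 0 1 θ = toDisc a t := by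
    rcases lt_trichotomy (toDisc a t).arg 0 with h | h | h
    · refine ⟨(toDisc a t).arg + 2 * Real.pi, ⟨?_, by linarith⟩, ?_⟩
      · have := neg_pi_lt_arg (toDisc a t)
        linarith
      · rw [periodic_circleMap, h2]
    · rw [h] at h2
      simp [circleMap] at h2
      exact absurd h2.symm h1
    · exact ⟨(toDisc a t).arg, ⟨h, by linarith [arg_le_pi (toDisc a t)]⟩, h2⟩
  refine ⟨θ, hθ, ?_⟩
  have h3 := ofDisc_circleMap a θ
  rw [hθ', ofDisc_toDisc ha h0] at h3
  exact_mod_cast h3.symm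

theorem integrableOn_comp_angleToReal {a : ℂ} (ha : 0 < a.im) {f : ℝ → ℝ} (hf : Integrable f) :
    IntegrableOn (fun θ => 2 * a.im / ‖1 - circleMap 0 1 θ‖ ^ 2 * f (angleToReal a θ))
      (Set.Ioo 0 (2 * Real.pi)) := by
  have h := (integrableOn_image_iff_integrableOn_abs_deriv_smul measurableSet_Ioo
    (fun x hx => (hasDerivAt_angleToReal a hx).hasDerivWithinAt) (angleToReal_injOn ha) f).1
    (by rw [angleToReal_image ha]; exact hf.integrableOn)
  refine h.congr_fun (fun θ _ => ?_) measurableSet_Ioo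
  simp only [smul_eq_mul]
  rw [abs_of_nonneg (by positivity)]

theorem integral_comp_angleToReal {a : ℂ} (ha : 0 < a.im) (f : ℝ → ℝ) :
    ∫ θ in Set.Ioo 0 (2 * Real.pi),
      2 * a.im / ‖1 - circleMap 0 1 θ‖ ^ 2 * f (angleToReal a θ) = ∫ t, f t := by
  have h := integral_image_eq_integral_abs_deriv_smul measurableSet_Ioo
    (fun x hx => (hasDerivAt_angleToReal a hx).hasDerivWithinAt) (angleToReal_injOn ha) f
  rw [angleToReal_image ha, setIntegral_univ] at h
  rw [h]
  refine setIntegral_congr_fun measurableSet_Ioo fun θ _ => ?_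
  simp only [smul_eq_mul]
  rw [abs_of_nonneg (by positivity)]

/-! ### Phragmén-Lindelöf and the `H²` growth estimate. -/

/-- Phragmén-Lindelöf: a function of exponential growth `exp (C * im z)` in the upper half-plane
whose growth along the imaginary axis is subexponential is bounded by `1`. -/
theorem norm_le_one_of_subexponential {H : ℂ → ℂ} {C : ℝ} (hC : 0 ≤ C)
    (hH : DifferentiableOn ℂ H upperHalf) (hle : ∀ z ∈ upperHalf, ‖H z‖ ≤ Real.exp (C * z.im))
    (him : ∀ ε > 0, ∀ᶠ y : ℝ in atTop, ‖H (I * y)‖ ≤ Real.exp (ε * y)) {z : ℂ}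
    (hz : z ∈ upperHalf) : ‖H z‖ ≤ 1 := by
  have hopen : IsOpen upperHalf := isOpen_lt continuous_const continuous_im
  have key : ∀ η ∈ Set.Ioo 0 z.im, ‖H z‖ ≤ Real.exp (C * η + η * z.im) := by
    rintro η ⟨hη, hηz⟩
    -- The shift by `I * η` moves the boundary inside the half-plane, where `H` is continuous and at
    -- most `exp (C * η)`. The factor `exp (-η * w)` absorbs the subexponential growth on the
    -- positive axis. Finally `η → 0`.
    set f : ℂ → ℂ := fun w => H (I * w + I * η) * exp (-η * w) with hf
    have hmem : ∀ w : ℂ, 0 ≤ w.re → I * w + I * η ∈ upperHalf := fun w hw => by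
      simp only [upperHalf, Set.mem_ofPred_eq, add_im, mul_im, I_re, I_im, ofReal_re]
      simp
      linarith
    have hfn : ∀ w : ℂ, 0 ≤ w.re → ‖f w‖ ≤ Real.exp (C * η) * Real.exp (C * w.re) := by
      intro w hw
      have h1 := hle _ (hmem w hw)
      have h2 : ‖exp (-η * w)‖ ≤ 1 := by
        rw [norm_exp, Real.exp_le_one_iff]
        simp
        positivity
      have h3 : (I * w + I * η).im = w.re + η := by simp
      rw [h3] at h1
      rw [hf, norm_mul, ← Real.exp_add]
      calc _ ≤ Real.exp (C * (w.re + η)) * 1 := by gcongr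
        _ = _ := by rw [mul_one]; ring_nf
    have hd : DiffContOnCl ℂ f {w | 0 < w.re} := by
      refine DifferentiableOn.diffContOnCl ?_
      rw [closure_setOfPred_lt_re]
      intro w hw
      have h1 : DifferentiableAt ℂ H (I * w + I * η) :=
        hH.differentiableAt (hopen.mem_nhds (hmem w hw))
      have h2 : DifferentiableAt ℂ (fun w : ℂ => H (I * w + I * η)) w :=
        h1.comp w (by fun_prop)
      exact (h2.mul (by fun_prop)).differentiableWithinAt
    have hw : 0 ≤ (-I * z - η).re := by
      simp
      linarith
    have hPL := PhragmenLindelof.right_half_plane_of_bounded_on_real (C := Real.exp (C * η)) hd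
      ⟨1, by norm_num, C, ?_⟩ ?_ ?_ hw
    · have h4 : I * (-I * z - η) + I * η = z := by linear_combination -z * I_mul_I
      simp only [hf, h4, norm_mul, norm_exp] at hPL
      have h5 : (-(η : ℂ) * (-I * z - η)).re = -(η * z.im) + η * η := by
        simp
        ring
      rw [h5] at hPL
      have h6 : ‖H z‖ * Real.exp (-(η * z.im)) ≤ Real.exp (C * η) := by
        refine le_trans ?_ hPL
        gcongr
        nlinarith
      rwa [Real.exp_neg, mul_inv_le_iff₀ (Real.exp_pos _), ← Real.exp_add] at h6
    · refine Asymptotics.IsBigO.of_bound (Real.exp (C * η)) ?_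
      rw [eventually_inf_principal]
      refine Eventually.of_forall fun w hw => (hfn w hw.le).trans ?_
      rw [Real.norm_of_nonneg (Real.exp_pos _).le, Real.rpow_one]
      gcongr
      exact re_le_norm w
    · have h7 := (tendsto_atTop_add_const_right atTop η tendsto_id).eventually (him η hη)
      refine isBoundedUnder_of_eventually_le (a := Real.exp (η * η)) ?_
      filter_upwards [h7] with x hx
      simp only [id] at hx
      have h8 : I * (x : ℂ) + I * η = I * ((x + η : ℝ) : ℂ) := by push_cast; ring
      rw [hf, norm_mul, h8, norm_exp]
      have h9 : (-(η : ℂ) * x).re = -(η * x) := by simp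
      rw [h9]
      calc _ ≤ Real.exp (η * (x + η)) * Real.exp (-(η * x)) := by gcongr
        _ = _ := by rw [← Real.exp_add]; ring_nf
    · intro x
      have := hfn (x * I) (by simp)
      simpa using this
  have ht : Tendsto (fun η : ℝ => Real.exp (C * η + η * z.im)) (𝓝[>] 0)
      (𝓝 (Real.exp (C * 0 + 0 * z.im))) :=
    (Continuous.tendsto (by fun_prop) 0).mono_left nhdsWithin_le_nhds
  rw [mul_zero, zero_mul, add_zero, Real.exp_zero] at ht
  refine ge_of_tendsto ht ?_
  filter_upwards [Ioo_mem_nhdsGT (show (0 : ℝ) < z.im from hz)] with η hη using key η hη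

theorem posLog_le_sq {x : ℝ} (hx : 0 ≤ x) : posLog x ≤ x ^ 2 := by
  rw [Real.posLog_apply]
  refine max_le (sq_nonneg x) ?_
  have h := Real.log_le_self hx
  rcases hx.eq_or_lt with rfl | h0
  · simp
  · have := Real.log_le_sub_one_of_pos h0
    nlinarith [sq_nonneg (x - 1)]

/-- The `1` is the price of `log⁺` in place of `log`; `norm_sq_le_of_boundedType` removes it by
scaling. -/
theorem exp_two_posLog_le {x : ℝ} (hx : 0 ≤ x) : Real.exp (2 * posLog x) ≤ 1 + x ^ 2 := by
  rw [Real.posLog_eq_log_max_one hx, ← Real.log_rpow (lt_max_of_lt_left one_pos),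
    Real.exp_log (by positivity), Real.rpow_two]
  rcases le_total 1 x with h | h
  · rw [max_eq_right h]
    linarith
  · rw [max_eq_left h]
    nlinarith

/-- Jensen's inequality for the exponential and the Poisson kernel. -/
theorem exp_circleAverage_poisson_le {w : ℂ} (hw : w ∈ Metric.ball (0 : ℂ) 1) {v V : ℂ → ℝ}
    (hv : CircleIntegrable v 0 1)
    (hV : CircleIntegrable (fun z => (herglotzRieszKernel 0 w z).re * V z) 0 1)
    (hvV : ∀ z ∈ Metric.sphere (0 : ℂ) 1, Real.exp (v z) ≤ V z) :
    Real.exp (Real.circleAverage (fun z => (herglotzRieszKernel 0 w z).re * v z) 0 1) ≤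
      Real.circleAverage (fun z => (herglotzRieszKernel 0 w z).re * V z) 0 1 := by
  set K : ℂ → ℝ := fun z => (herglotzRieszKernel 0 w z).re with hK
  have hKc : ContinuousOn K (Metric.sphere 0 1) := continuousOn_re_herglotzRieszKernel hw
  have hKi : CircleIntegrable K 0 1 := hKc.circleIntegrable zero_le_one
  have hKv : CircleIntegrable (fun z => K z * v z) 0 1 :=
    hv.continuousOn_smul (g := K) (by rwa [abs_one])
  set m := Real.circleAverage (fun z => K z * v z) 0 1 with hm
  -- The tangent to `exp` at the mean `m` averages to `exp m` against the kernel, whose total mass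
  -- is one; it lies below `exp`.
  have h1 : Real.circleAverage
      (fun z => Real.exp m • (K z * v z) + (Real.exp m * (1 - m)) • K z) 0 1 = Real.exp m := by
    have hi1 : CircleIntegrable (fun z => Real.exp m • (K z * v z)) 0 1 := hKv.const_smul
    have hi2 : CircleIntegrable (fun z => (Real.exp m * (1 - m)) • K z) 0 1 := hKi.const_smul
    rw [Real.circleAverage_fun_add hi1 hi2, Real.circleAverage_fun_smul,
      Real.circleAverage_fun_smul, circleAverage_re_herglotzRieszKernel hw, ← hm]
    simp only [smul_eq_mul]
    ring
  rw [← h1]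
  refine Real.circleAverage_mono ?_ hV fun z hz => ?_
  · exact (hKv.const_smul (a := Real.exp m)).add (hKi.const_smul (a := Real.exp m * (1 - m)))
  · rw [abs_one] at hz
    have h2 : 0 ≤ K z := re_herglotzRieszKernel_nonneg hw hz
    have h3 : Real.exp m * (v z - m + 1) ≤ Real.exp (v z) := by
      have := Real.add_one_le_exp (v z - m)
      calc Real.exp m * (v z - m + 1) ≤ Real.exp m * Real.exp (v z - m) := by gcongr
        _ = Real.exp (v z) := by rw [← Real.exp_add]; ring_nf
    have h4 := mul_le_mul_of_nonneg_left (h3.trans (hvV z hz)) h2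
    simp only [smul_eq_mul]
    calc _ = K z * (Real.exp m * (v z - m + 1)) := by ring
      _ ≤ _ := h4

/-- The weight equals `4 / |1 - ζ|²` and `|1 - ζ| ≤ 2`. Hence square integrability on the line
implies square integrability on the circle. -/
theorem one_le_weight {a : ℂ} (ha : 0 < a.im) {θ : ℝ} (hθ : θ ∈ Set.Ioo 0 (2 * Real.pi)) :
    1 ≤ 2 / a.im * (2 * a.im / ‖1 - circleMap 0 1 θ‖ ^ 2) := by
  have h1 : 0 < ‖1 - circleMap 0 1 θ‖ := norm_pos_iff.2 (sub_ne_zero.2 (circleMap_ne_one hθ).symm)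
  have h2 : ‖1 - circleMap 0 1 θ‖ ≤ 2 := by
    refine (norm_sub_le _ _).trans ?_
    simp
    norm_num
  rw [show 2 / a.im * (2 * a.im / ‖1 - circleMap 0 1 θ‖ ^ 2) = 4 / ‖1 - circleMap 0 1 θ‖ ^ 2 by
    field_simp; norm_num, one_le_div (by positivity)]
  nlinarith

theorem circleIntegrable_of_Ioo {f : ℂ → ℝ}
    (hf : IntegrableOn (fun θ => f (circleMap 0 1 θ)) (Set.Ioo 0 (2 * Real.pi))) :
    CircleIntegrable f 0 1 := by
  rw [CircleIntegrable, intervalIntegrable_iff_integrableOn_Ioo_of_le Real.two_pi_pos.le]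
  exact hf

/-- A function of bounded type in the upper half-plane, continuous up to the real line, with
subexponential growth along the imaginary axis and square integrable boundary values, up to an
additive constant. -/
theorem norm_sq_le_one_add {G p q : ℂ → ℂ} (hGc : ContinuousOn G {z | 0 ≤ z.im})
    (hGd : DifferentiableOn ℂ G upperHalf) (hq : DifferentiableOn ℂ q upperHalf)
    (hp1 : ∀ z ∈ upperHalf, ‖p z‖ ≤ 1) (hq1 : ∀ z ∈ upperHalf, ‖q z‖ ≤ 1)
    (hGq : ∀ z ∈ upperHalf, G z * q z = p z) {a : ℂ} (ha : a ∈ upperHalf) (hqa : q a ≠ 0)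
    (him : ∀ ε > 0, ∀ᶠ y : ℝ in atTop, ‖G (I * y)‖ ≤ Real.exp (ε * y))
    (hL2 : Integrable fun t : ℝ => ‖G t‖ ^ 2) {z : ℂ} (hz : z ∈ upperHalf) :
    ‖G z‖ ^ 2 ≤ 1 + (∫ t : ℝ, ‖G t‖ ^ 2) / (Real.pi * z.im) := by
  have ha' : 0 < a.im := ha
  have hopen : IsOpen upperHalf := isOpen_lt continuous_const continuous_im
  have hball1 : ∀ ζ ∈ Metric.ball (0 : ℂ) 1, ζ ≠ 1 := by
    rintro ζ hζ rfl
    simp at hζ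
  have hmaps : Set.MapsTo (ofDisc a) (Metric.ball 0 1) upperHalf :=
    fun ζ hζ => im_ofDisc_pos ha' hζ
  have hod : DifferentiableOn ℂ (ofDisc a) (Metric.ball 0 1) :=
    fun ζ hζ => (differentiableAt_ofDisc (hball1 ζ hζ)).differentiableWithinAt
  set g : ℂ → ℂ := fun ζ => G (ofDisc a ζ) with hg
  have hgd : DifferentiableOn ℂ g (Metric.ball 0 1) := hGd.comp hod hmaps
  have hqd : DifferentiableOn ℂ (fun ζ => q (ofDisc a ζ)) (Metric.ball 0 1) := hq.comp hod hmaps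
  have hgc : ContinuousOn g (Metric.closedBall 0 1 \ {1}) := by
    refine hGc.comp (fun ζ hζ => (differentiableAt_ofDisc hζ.2).continuousAt.continuousWithinAt)
      fun ζ hζ => im_ofDisc_nonneg ha' hζ.1
  have hq0 : (fun ζ => q (ofDisc a ζ)) 0 ≠ 0 := by simpa [ofDisc] using hqa
  set C := -Real.log ‖(fun ζ => q (ofDisc a ζ)) 0‖ with hC
  have hC0 : 0 ≤ C := by
    rw [hC, Left.nonneg_neg_iff]
    exact Real.log_nonpos (norm_nonneg _) (hq1 _ (hmaps (Metric.mem_ball_self one_pos)))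
  have hcirc : ContinuousOn (fun θ => g (circleMap 0 1 θ)) (Set.Ioo 0 (2 * Real.pi)) :=
    hgc.comp (continuous_circleMap 0 1).continuousOn
      fun θ hθ => ⟨by simp, circleMap_ne_one hθ⟩
  have hgt : ∀ θ, g (circleMap 0 1 θ) = G (angleToReal a θ) := fun θ => by
    rw [hg]
    simp only [ofDisc_circleMap]
  have hw := integrableOn_comp_angleToReal ha' hL2
  have hsq : CircleIntegrable (fun ζ => ‖g ζ‖ ^ 2) 0 1 := by
    refine circleIntegrable_of_Ioo ((hw.const_mul (2 / a.im)).mono'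
      ((hcirc.norm.pow 2).aestronglyMeasurable measurableSet_Ioo) ?_)
    filter_upwards [ae_restrict_mem measurableSet_Ioo] with θ hθ
    rw [Real.norm_of_nonneg (by positivity), hgt, ← mul_assoc]
    exact le_mul_of_one_le_left (by positivity) (one_le_weight ha' hθ)
  set u : ℂ → ℝ := fun ζ => posLog ‖g ζ‖ with hu
  have hui : CircleIntegrable u 0 1 := by
    rw [CircleIntegrable, intervalIntegrable_iff_integrableOn_Ioo_of_le Real.two_pi_pos.le] at hsq
    refine circleIntegrable_of_Ioo (hsq.mono'
      ((Real.continuous_posLog.comp_continuousOn hcirc.norm).aestronglyMeasurable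
        measurableSet_Ioo) (Eventually.of_forall fun θ => ?_))
    rw [Real.norm_of_nonneg Real.posLog_nonneg]
    exact posLog_le_sq (norm_nonneg _)
  set A : ℂ → ℝ := fun w =>
    Real.circleAverage (fun ζ => (herglotzRieszKernel 0 w ζ).re * u ζ) 0 1 with hA
  set S : ℂ → ℂ := fun w =>
    Real.circleAverage (fun ζ => herglotzRieszKernel 0 w ζ • (u ζ : ℂ)) 0 1 with hS
  have hSre : ∀ w ∈ Metric.ball (0 : ℂ) 1, (S w).re = A w := fun w hw =>
    re_circleAverage_herglotzRieszKernel_smul hui hw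
  have hSd : DifferentiableOn ℂ S (Metric.ball 0 1) := by
    refine differentiableOn_circleAverage_herglotzRieszKernel_smul ?_
    rw [CircleIntegrable, intervalIntegrable_iff] at hui ⊢
    exact ofRealCLM.integrable_comp hui
  have hA0 : ∀ w ∈ Metric.ball (0 : ℂ) 1, 0 ≤ A w := fun w hw =>
    Real.circleAverage_nonneg_of_nonneg fun ζ hζ => by
      rw [abs_one] at hζ
      exact mul_nonneg (re_herglotzRieszKernel_nonneg hw hζ) Real.posLog_nonneg
  have htd : DifferentiableOn ℂ (toDisc a) upperHalf := fun w hw => by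
    have : w - conj a ≠ 0 := sub_conj_ne_zero ha' (le_of_lt hw)
    unfold toDisc
    exact DifferentiableAt.differentiableWithinAt (by fun_prop (disch := assumption))
  have htm : Set.MapsTo (toDisc a) upperHalf (Metric.ball 0 1) :=
    fun w hw => toDisc_mem_ball ha' hw
  have hGle : ∀ w ∈ upperHalf, ‖G w‖ ≤ Real.exp (A (toDisc a w) + C / a.im * w.im) := by
    intro w hw
    have h := norm_le_exp_poisson_add hgd hgc hqd (p := fun ζ => p (ofDisc a ζ))
      (fun ζ hζ => hp1 _ (hmaps hζ)) (fun ζ hζ => hq1 _ (hmaps hζ))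
      (fun ζ hζ => hGq _ (hmaps hζ)) hq0 hui (htm hw)
    rw [re_herglotzRieszKernel_toDisc_one ha' hw] at h
    simp only [hg, ofDisc_toDisc ha' (le_of_lt hw)] at h
    refine h.trans (Real.exp_le_exp.2 (le_of_eq ?_))
    rw [hA, hC]
    ring
  -- `S` is analytic with real part the Poisson integral `A`, so dividing by `exp S` leaves only the
  -- point-mass growth `exp (C / a.im * im w)`. Since `A ≥ 0`, `H` inherits subexponential growth on
  -- the imaginary axis, and Phragmén-Lindelöf gives `‖G‖ ≤ exp A`.
  set H : ℂ → ℂ := fun w => G w * exp (-S (toDisc a w)) with hH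
  have hHn : ∀ w ∈ upperHalf, ‖H w‖ = ‖G w‖ * Real.exp (-A (toDisc a w)) := fun w hw => by
    rw [hH, norm_mul, norm_exp, neg_re, hSre _ (htm hw)]
  have hH1 : ‖H z‖ ≤ 1 := by
    refine norm_le_one_of_subexponential (C := C / a.im) (by positivity) ?_ ?_ ?_ hz
    · exact hGd.mul (DifferentiableOn.cexp (hSd.comp htd htm).neg)
    · intro w hw
      rw [hHn w hw, Real.exp_neg, mul_inv_le_iff₀ (Real.exp_pos _), ← Real.exp_add, add_comm]
      exact hGle w hw
    · intro ε hε
      filter_upwards [him ε hε, eventually_gt_atTop 0] with y hy hy0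
      have hyU : I * (y : ℂ) ∈ upperHalf := by simpa [upperHalf] using hy0
      rw [hHn _ hyU]
      refine le_trans (mul_le_of_le_one_right (norm_nonneg _) ?_) hy
      rw [Real.exp_le_one_iff, Left.neg_nonpos_iff]
      exact hA0 _ (htm hyU)
  rw [hHn z hz, Real.exp_neg, mul_inv_le_iff₀ (Real.exp_pos _), one_mul] at hH1
  set w := toDisc a z with hwz
  have hwb : w ∈ Metric.ball (0 : ℂ) 1 := htm hz
  have hKc : ContinuousOn (fun ζ => (herglotzRieszKernel 0 w ζ).re) (Metric.sphere 0 1) :=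
    continuousOn_re_herglotzRieszKernel hwb
  have hKi : CircleIntegrable (fun ζ => (herglotzRieszKernel 0 w ζ).re) 0 1 :=
    hKc.circleIntegrable zero_le_one
  have hKsq : CircleIntegrable (fun ζ => (herglotzRieszKernel 0 w ζ).re * ‖g ζ‖ ^ 2) 0 1 :=
    hsq.continuousOn_smul (g := fun ζ => (herglotzRieszKernel 0 w ζ).re) (by rwa [abs_one])
  have hJ := exp_circleAverage_poisson_le hwb (v := fun ζ => (2 : ℝ) • u ζ)
    (V := fun ζ => 1 + ‖g ζ‖ ^ 2) hui.const_smul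
    (by simpa only [mul_add, mul_one] using! hKi.add hKsq)
    (fun ζ _ => exp_two_posLog_le (norm_nonneg _))
  have e1 : Real.circleAverage (fun ζ => (herglotzRieszKernel 0 w ζ).re * (2 : ℝ) • u ζ) 0 1 =
      2 * A w := by
    rw [hA, ← smul_eq_mul, ← Real.circleAverage_fun_smul]
    refine congrArg (fun f => Real.circleAverage f 0 1) (funext fun ζ => ?_)
    simp only [smul_eq_mul]
    ring
  have e2 : Real.circleAverage (fun ζ => (herglotzRieszKernel 0 w ζ).re * (1 + ‖g ζ‖ ^ 2)) 0 1 =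
      1 + Real.circleAverage (fun ζ => (herglotzRieszKernel 0 w ζ).re * ‖g ζ‖ ^ 2) 0 1 := by
    simp only [mul_add, mul_one]
    rw [Real.circleAverage_fun_add hKi hKsq, circleAverage_re_herglotzRieszKernel hwb]
  rw [e1, e2] at hJ
  have hz' : 0 < z.im := hz
  have e3 : Real.circleAverage (fun ζ => (herglotzRieszKernel 0 w ζ).re * ‖g ζ‖ ^ 2) 0 1 ≤
      (∫ t : ℝ, ‖G t‖ ^ 2) / (Real.pi * z.im) := by
    rw [Real.circleAverage_def, intervalIntegral.integral_of_le Real.two_pi_pos.le,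
      integral_Ioc_eq_integral_Ioo, smul_eq_mul]
    rw [CircleIntegrable, intervalIntegrable_iff_integrableOn_Ioo_of_le Real.two_pi_pos.le] at hKsq
    have h1 : ∫ θ in Set.Ioo 0 (2 * Real.pi), (herglotzRieszKernel 0 w (circleMap 0 1 θ)).re *
        ‖g (circleMap 0 1 θ)‖ ^ 2 ≤ 2 / z.im * ∫ t : ℝ, ‖G t‖ ^ 2 := by
      rw [← integral_comp_angleToReal ha' (fun t : ℝ => ‖G t‖ ^ 2), ← integral_const_mul]
      refine setIntegral_mono_on hKsq (hw.const_mul (2 / z.im)) measurableSet_Ioo fun θ hθ => ?_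
      have h2 := re_herglotzRieszKernel_toDisc_le ha' hz' (angleToReal a θ)
      rw [toDisc_angleToReal ha' hθ] at h2
      rw [hgt, ← mul_assoc]
      gcongr
    refine (mul_le_mul_of_nonneg_left h1 (by positivity)).trans (le_of_eq ?_)
    have := Real.pi_pos
    field_simp
  calc ‖G z‖ ^ 2 ≤ Real.exp (A w) ^ 2 := by gcongr
    _ = Real.exp (2 * A w) := by rw [← Real.exp_nat_mul]; norm_num
    _ ≤ _ := hJ.trans (by linarith)

/-- A function of bounded type and nonpositive mean type in the upper half-plane, continuous up to
the real line, with square integrable boundary values, satisfies the `H²` growth estimate. -/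
theorem norm_sq_le_of_boundedType {G : ℂ → ℂ} (hGc : ContinuousOn G {z | 0 ≤ z.im})
    (hG : IsBoundedType G)
    (him : ∀ ε > 0, ∀ᶠ y : ℝ in atTop, ‖G (I * y)‖ ≤ Real.exp (ε * y))
    (hL2 : Integrable fun t : ℝ => ‖G t‖ ^ 2) {z : ℂ} (hz : z ∈ upperHalf) :
    ‖G z‖ ^ 2 ≤ (∫ t : ℝ, ‖G t‖ ^ 2) / (Real.pi * z.im) := by
  obtain ⟨hGd, p, q, ⟨hp, Cp, hCp⟩, ⟨hq, Cq, hCq⟩, ⟨a, ha, hqa⟩, hGq⟩ := hG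
  -- Applied to `c * G`, the additive constant `1` becomes `1 / c²`, which disappears as `c → ∞`.
  -- Dividing numerator and denominator by the same `M` makes both bounded by `1`.
  have hscale : ∀ c : ℝ, 0 < c →
      ‖G z‖ ^ 2 ≤ 1 / c ^ 2 + (∫ t : ℝ, ‖G t‖ ^ 2) / (Real.pi * z.im) := by
    intro c hc
    set M : ℝ := max 1 (max (c * Cp) Cq) with hM
    have hM0 : 0 < M := lt_max_of_lt_left one_pos
    have hMC : (M : ℂ) ≠ 0 := by exact_mod_cast hM0.ne'
    have h := norm_sq_le_one_add (G := fun w => c * G w) (p := fun w => c * p w / M)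
      (q := fun w => q w / M) (a := a) (z := z)
      (continuousOn_const.mul hGc) (hGd.const_mul _) (hq.div_const _)
      (fun w hw => by
        rw [norm_div, norm_mul, norm_real, norm_real, Real.norm_of_nonneg hM0.le,
          Real.norm_of_nonneg hc.le, div_le_one hM0]
        exact (mul_le_mul_of_nonneg_left (hCp w hw) hc.le).trans
          ((le_max_left _ _).trans (le_max_right _ _)))
      (fun w hw => by
        rw [norm_div, norm_real, Real.norm_of_nonneg hM0.le, div_le_one hM0]
        exact (hCq w hw).trans ((le_max_right _ _).trans (le_max_right _ _)))
      (fun w hw => by rw [← hGq w hw]; ring) ha (div_ne_zero hqa hMC)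
      (fun ε hε => by
        have hlarge : ∀ᶠ y : ℝ in atTop, Real.log c ≤ ε / 2 * y :=
          (tendsto_id.const_mul_atTop (half_pos hε)).eventually_ge_atTop _
        filter_upwards [him (ε / 2) (half_pos hε), hlarge] with y hy hy2
        rw [norm_mul, norm_real, Real.norm_of_nonneg hc.le]
        calc c * ‖G (I * y)‖ ≤ Real.exp (ε / 2 * y) * Real.exp (ε / 2 * y) := by
              gcongr
              exact (Real.log_le_iff_le_exp hc).1 hy2
          _ = Real.exp (ε * y) := by rw [← Real.exp_add]; ring_nf)
      (by
        simp only [norm_mul, mul_pow]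
        exact hL2.const_mul _) hz
    simp only [norm_mul, mul_pow, norm_real, Real.norm_of_nonneg hc.le] at h
    rw [integral_const_mul] at h
    have hc2 : 0 < c ^ 2 := by positivity
    refine le_of_mul_le_mul_left (h.trans (le_of_eq ?_)) hc2
    field_simp
  have ht : Tendsto (fun c : ℝ => 1 / c ^ 2 + (∫ t : ℝ, ‖G t‖ ^ 2) / (Real.pi * z.im)) atTop
      (𝓝 (0 + (∫ t : ℝ, ‖G t‖ ^ 2) / (Real.pi * z.im))) := by
    refine Tendsto.add_const _ ?_
    simp only [one_div]
    exact (tendsto_pow_atTop two_ne_zero).inv_tendsto_atTop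
  rw [zero_add] at ht
  exact ge_of_tendsto ht ((eventually_gt_atTop 0).mono hscale)

/-! ### Cauchy's theorem and formula in the half-plane. -/

/-- Cauchy's theorem in the upper half-plane, for functions decaying like
`(im z) ^ (-1/2) / ‖z‖`. -/
theorem integral_eq_zero_of_decay {h : ℂ → ℂ} (hc : ContinuousOn h {z | 0 ≤ z.im})
    (hd : DifferentiableOn ℂ h upperHalf) (hint : Integrable fun t : ℝ => h t) {B R₀ : ℝ}
    (hB : ∀ z ∈ upperHalf, R₀ ≤ ‖z‖ → ‖h z‖ ≤ B * z.im ^ (-(1 / 2) : ℝ) / ‖z‖) :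
    ∫ t : ℝ, h t = 0 := by
  have hlim : Tendsto (fun R : ℝ => ∫ x in (-R)..R, h x) atTop (𝓝 (∫ t : ℝ, h t)) :=
    intervalIntegral_tendsto_integral hint tendsto_neg_atTop_atBot tendsto_id
  have hB' : ∀ z ∈ upperHalf, R₀ ≤ ‖z‖ → ‖h z‖ ≤ |B| * z.im ^ (-(1 / 2) : ℝ) / ‖z‖ := by
    intro z hz hR
    have hz' : 0 < z.im := hz
    refine (hB z hz hR).trans ?_
    gcongr
    exact le_abs_self B
  -- The contour is the rectangle with corners `-R` and `R + R * I`. The three remaining sides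
  -- contribute at most `2 |B| R^(-1/2)` each: `∫₀ᴿ y^(-1/2) dy / R` on a vertical side, and length
  -- `2R` times `R^(-1/2) / R` on the top.
  have hbound : ∀ᶠ R : ℝ in atTop,
      ‖∫ x in (-R)..R, h x‖ ≤ 6 * |B| * R ^ (-(1 / 2) : ℝ) := by
    filter_upwards [eventually_ge_atTop R₀, eventually_gt_atTop 0] with R hR hR0
    have hrect := Complex.integral_boundary_rect_eq_zero_of_continuousOn_of_differentiableOn h
      (-R : ℂ) (R + R * I) (hc.mono ?_) (hd.mono ?_)
    · simp only [neg_re, ofReal_re, add_re, mul_re, I_re, mul_zero, ofReal_im, I_im, mul_one,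
        sub_self, add_zero, neg_im, neg_zero, add_im, mul_im, zero_add, ofReal_zero,
        zero_mul, ofReal_neg] at hrect
      have hside : ∀ s : ℝ, |s| = R →
          ‖∫ y in (0 : ℝ)..R, h (s + y * I)‖ ≤ 2 * |B| * R ^ (-(1 / 2) : ℝ) := by
        intro s hs
        have hi : IntervalIntegrable (fun y : ℝ => |B| / R * y ^ (-(1 / 2) : ℝ)) volume 0 R :=
          (intervalIntegral.intervalIntegrable_rpow' (by norm_num)).const_mul _
        have h1 := intervalIntegral.norm_integral_le_of_norm_le hR0.le (g := fun y : ℝ =>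
          |B| / R * y ^ (-(1 / 2) : ℝ)) (f := fun y : ℝ => h (s + y * I)) (μ := volume) ?_ hi
        · refine h1.trans (le_of_eq ?_)
          rw [intervalIntegral.integral_const_mul, integral_rpow (Or.inl (by norm_num))]
          have e1 : (-(1 / 2) + 1 : ℝ) = 1 + -(1 / 2) := by norm_num
          rw [Real.zero_rpow (by norm_num), e1, Real.rpow_add hR0, Real.rpow_one]
          field_simp
          norm_num
          ring
        · refine Eventually.of_forall fun y hy => ?_
          have him : ((s : ℂ) + y * I).im = y := by simp
          have hre : ((s : ℂ) + y * I).re = s := by simp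
          have hn : R ≤ ‖(s : ℂ) + y * I‖ := by
            have := abs_re_le_norm ((s : ℂ) + y * I)
            rwa [hre, hs] at this
          have hmem : (s : ℂ) + y * I ∈ upperHalf := by
            rw [upperHalf, Set.mem_ofPred_eq, him]
            exact hy.1
          have h2 := hB' _ hmem (hR.trans hn)
          rw [him] at h2
          refine h2.trans ?_
          have hy0 := hy.1
          rw [div_mul_eq_mul_div]
          gcongr
      have htop : ‖∫ x in (-R)..R, h (x + R * I)‖ ≤ 2 * |B| * R ^ (-(1 / 2) : ℝ) := by
        have h1 := intervalIntegral.norm_integral_le_of_norm_le_const (a := -R) (b := R)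
          (f := fun x : ℝ => h (x + R * I)) (C := |B| * R ^ (-(1 / 2) : ℝ) / R) ?_
        · refine h1.trans (le_of_eq ?_)
          rw [sub_neg_eq_add, abs_of_pos (add_pos hR0 hR0)]
          field_simp
          ring
        · intro x _
          have him : ((x : ℂ) + R * I).im = R := by simp
          have hn : R ≤ ‖(x : ℂ) + R * I‖ := by
            have := abs_im_le_norm ((x : ℂ) + R * I)
            rwa [him, abs_of_pos hR0] at this
          have hmem : (x : ℂ) + R * I ∈ upperHalf := by
            rw [upperHalf, Set.mem_ofPred_eq, him]
            exact hR0
          have h2 := hB' _ hmem (hR.trans hn)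
          rw [him] at h2
          refine h2.trans ?_
          gcongr
      have h3 := hside R (abs_of_pos hR0)
      have h4 := hside (-R) (by rw [abs_neg, abs_of_pos hR0])
      rw [ofReal_neg] at h4
      have h5 : ∫ x in (-R)..R, h x = (∫ x in (-R)..R, h (x + R * I)) -
          I • (∫ y in (0 : ℝ)..R, h (R + y * I)) + I • ∫ y in (0 : ℝ)..R, h (-R + y * I) := by
        linear_combination hrect
      rw [h5]
      refine (norm_add_le _ _).trans ((add_le_add_left (norm_sub_le _ _) _).trans ?_)
      rw [norm_smul, norm_smul, norm_I, one_mul, one_mul]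
      linarith
    · rintro z hz
      rw [mem_reProdIm] at hz
      have := hz.2
      simp only [neg_im, ofReal_im, neg_zero, add_im, mul_im, ofReal_re, I_im, mul_one, I_re,
        mul_zero, add_zero, zero_add, Set.uIcc_of_le hR0.le] at this
      exact this.1
    · rintro z hz
      rw [mem_reProdIm] at hz
      have := hz.2
      simp only [neg_im, ofReal_im, neg_zero, add_im, mul_im, ofReal_re, I_im, mul_one, I_re,
        mul_zero, add_zero, zero_add, min_eq_left hR0.le] at this
      exact this.1
  have h0 : Tendsto (fun R : ℝ => 6 * |B| * R ^ (-(1 / 2) : ℝ)) atTop (𝓝 (6 * |B| * 0)) :=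
    (tendsto_rpow_neg_atTop (by norm_num)).const_mul _
  rw [mul_zero] at h0
  exact tendsto_nhds_unique hlim (squeeze_zero_norm' hbound h0)

theorem sq_norm_ofReal_sub (t : ℝ) (c : ℂ) : ‖(t : ℂ) - c‖ ^ 2 = (t - c.re) ^ 2 + c.im ^ 2 := by
  rw [← normSq_eq_norm_sq, normSq_apply]
  simp
  ring

theorem ofReal_sub_ne_zero {c : ℂ} (hc : c.im ≠ 0) (t : ℝ) : (t : ℂ) - c ≠ 0 := by
  intro h
  have := congrArg im h
  simp at this
  exact hc this

theorem integral_inv_sq_add_sq (u : ℝ) {v : ℝ} (hv : 0 < v) :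
    Integrable (fun t : ℝ => ((t - u) ^ 2 + v ^ 2)⁻¹) ∧
      ∫ t : ℝ, ((t - u) ^ 2 + v ^ 2)⁻¹ = Real.pi / v := by
  have h1 : (fun t : ℝ => ((t - u) ^ 2 + v ^ 2)⁻¹) =
      fun t : ℝ => (v ^ 2)⁻¹ * (1 + ((t - u) / v) ^ 2)⁻¹ := by
    funext t
    rw [← mul_inv]
    congr 1
    field_simp
    ring
  rw [h1]
  constructor
  · exact (((integrable_inv_one_add_sq.comp_div hv.ne').comp_sub_right u)).const_mul _
  · rw [integral_const_mul, integral_sub_right_eq_self (fun t : ℝ => (1 + (t / v) ^ 2)⁻¹) u,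
      Measure.integral_comp_div (fun t : ℝ => (1 + t ^ 2)⁻¹) v, integral_univ_inv_one_add_sq,
      abs_of_pos hv, smul_eq_mul]
    field_simp

theorem memLp_inv_sub {c : ℂ} (hc : c.im ≠ 0) :
    MemLp (fun t : ℝ => ((t : ℂ) - c)⁻¹) 2 volume := by
  have hcont : Continuous fun t : ℝ => ((t : ℂ) - c)⁻¹ :=
    Continuous.inv₀ (by fun_prop) (ofReal_sub_ne_zero hc)
  rw [memLp_two_iff_integrable_sq_norm hcont.aestronglyMeasurable]
  have := (integral_inv_sq_add_sq c.re (abs_pos.2 hc)).1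
  refine this.congr (Eventually.of_forall fun t => ?_)
  simp only [norm_inv, inv_pow, sq_norm_ofReal_sub, sq_abs]

theorem integrable_div_sub {G : ℝ → ℂ} (hG : MemLp G 2 volume) {c : ℂ} (hc : c.im ≠ 0) :
    Integrable fun t : ℝ => G t / (t - c) := by
  simp only [div_eq_mul_inv]
  exact hG.integrable_mul (memLp_inv_sub hc)

theorem half_norm_le_norm_sub {z c : ℂ} (h : 2 * ‖c‖ ≤ ‖z‖) : ‖z‖ / 2 ≤ ‖z - c‖ := by
  have := norm_sub_norm_le z c
  linarith

theorem integral_div_sub_conj_eq_zero {G : ℂ → ℂ} (hGc : ContinuousOn G {z | 0 ≤ z.im})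
    (hGd : DifferentiableOn ℂ G upperHalf) (hL2 : MemLp (fun t : ℝ => G t) 2 volume) {M : ℝ}
    (hM : ∀ z ∈ upperHalf, ‖G z‖ ≤ M * z.im ^ (-(1 / 2) : ℝ)) {w : ℂ} (hw : w ∈ upperHalf) :
    ∫ t : ℝ, G t / (t - conj w) = 0 := by
  have hw' : 0 < w.im := hw
  refine integral_eq_zero_of_decay (h := fun z => G z / (z - conj w)) (B := 2 * M)
    (R₀ := max (2 * ‖w‖) 1)
    (hGc.div (by fun_prop) fun z hz => sub_conj_ne_zero hw hz)
    (hGd.div (by fun_prop) fun z hz => sub_conj_ne_zero hw (le_of_lt hz))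
    (integrable_div_sub hL2 (by simpa using hw'.ne')) fun z hz hR => ?_
  have h1 : ‖z‖ / 2 ≤ ‖z - conj w‖ :=
    half_norm_le_norm_sub (by rw [norm_conj]; exact (le_max_left _ _).trans hR)
  have h2 : 1 ≤ ‖z‖ := (le_max_right _ _).trans hR
  rw [norm_div]
  calc ‖G z‖ / ‖z - conj w‖ ≤ ‖G z‖ / (‖z‖ / 2) := by gcongr
    _ ≤ M * z.im ^ (-(1 / 2) : ℝ) / (‖z‖ / 2) := by gcongr; exact hM z hz
    _ = _ := by ring

/-- Subtracting `k / (z - conj w)` makes the numerator vanish at `w`, so the divided difference is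
analytic and Cauchy's theorem applies without a residue. The subtracted term contributes the
explicit integral of `1 / |t - w|²`. -/
theorem integral_div_sub_eq {G : ℂ → ℂ} (hGc : ContinuousOn G {z | 0 ≤ z.im})
    (hGd : DifferentiableOn ℂ G upperHalf) (hL2 : MemLp (fun t : ℝ => G t) 2 volume) {M : ℝ}
    (hM : ∀ z ∈ upperHalf, ‖G z‖ ≤ M * z.im ^ (-(1 / 2) : ℝ)) {w : ℂ} (hw : w ∈ upperHalf) :
    ∫ t : ℝ, G t / (t - w) = 2 * Real.pi * I * G w := by
  have hw' : 0 < w.im := hw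
  have hopen : IsOpen upperHalf := isOpen_lt continuous_const continuous_im
  have hnhds : {z : ℂ | 0 ≤ z.im} ∈ 𝓝 w :=
    mem_of_superset (hopen.mem_nhds hw) fun z (hz : 0 < z.im) => hz.le
  set k : ℂ := G w * (w - conj w) with hk
  set F : ℂ → ℂ := fun z => G z - k / (z - conj w) with hF
  have hF0 : F w = 0 := by
    simp only [hF, hk]
    rw [mul_div_assoc, div_self (self_sub_conj_ne_zero hw'), mul_one, sub_self]
  have hFc : ContinuousOn F {z | 0 ≤ z.im} :=
    hGc.sub (continuousOn_const.div (by fun_prop) fun z hz => sub_conj_ne_zero hw hz)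
  have hFd : DifferentiableOn ℂ F upperHalf :=
    hGd.sub ((differentiableOn_const _).div (by fun_prop)
      fun z hz => sub_conj_ne_zero hw (le_of_lt hz))
  have hslope : ∀ z, z ≠ w → dslope F w z = F z / (z - w) := fun z hz => by
    rw [dslope_of_ne _ hz, slope_def_field, hF0, sub_zero]
  have hne : ∀ t : ℝ, (t : ℂ) ≠ w := fun t => sub_ne_zero.1 (ofReal_sub_ne_zero hw'.ne' t)
  have hci : (conj w).im ≠ 0 := by simpa using hw'.ne'
  have hsplit : ∀ t : ℝ, dslope F w t =
      G t / (t - w) - k * (((t - w.re) ^ 2 + w.im ^ 2)⁻¹ : ℝ) := fun t => by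
    have h1 := ofReal_sub_ne_zero hw'.ne' t
    have h2 := ofReal_sub_ne_zero hci t
    have h3 : (((t - w.re) ^ 2 + w.im ^ 2 : ℝ) : ℂ) = (t - w) * (t - conj w) := by
      rw [← sq_norm_ofReal_sub, ofReal_pow, ← mul_conj']
      simp
    rw [hslope _ (hne t), ofReal_inv, h3, hF]
    field_simp
  obtain ⟨hi, hi2⟩ := integral_inv_sq_add_sq w.re hw'
  have hGi := integrable_div_sub hL2 hw'.ne'
  have hki : Integrable fun t : ℝ => k * ((((t - w.re) ^ 2 + w.im ^ 2)⁻¹ : ℝ) : ℂ) :=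
    hi.ofReal.const_mul k
  have h0 : ∫ t : ℝ, dslope F w t = 0 := by
    refine integral_eq_zero_of_decay (B := 2 * (M + 2 * ‖k‖)) (R₀ := max (2 * ‖w‖) 1)
      ((continuousOn_dslope hnhds).2 ⟨hFc, hFd.differentiableAt (hopen.mem_nhds hw)⟩)
      ((differentiableOn_dslope (hopen.mem_nhds hw)).2 hFd) ?_ fun z hz hR => ?_
    · simp only [hsplit]
      exact hGi.sub hki
    · have hz' : 0 < z.im := hz
      have hzw : 2 * ‖w‖ ≤ ‖z‖ := (le_max_left _ _).trans hR
      have hz1 : 1 ≤ ‖z‖ := (le_max_right _ _).trans hR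
      have h1 : ‖z‖ / 2 ≤ ‖z - conj w‖ := half_norm_le_norm_sub (by rwa [norm_conj])
      have h2 : ‖z‖ / 2 ≤ ‖z - w‖ := half_norm_le_norm_sub hzw
      have hzne : z ≠ w := by
        rintro rfl
        linarith
      -- The correction term decays like `1 / ‖z‖`; for `‖z‖ ≥ 1` this fits under the `(im
      -- z)^(-1/2)` bound for `G`.
      have h3 : 1 / ‖z‖ ≤ z.im ^ (-(1 / 2) : ℝ) := by
        rw [Real.rpow_neg hz'.le, one_div]
        refine inv_anti₀ (by positivity) ?_
        calc z.im ^ (1 / 2 : ℝ) ≤ ‖z‖ ^ (1 / 2 : ℝ) := by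
              gcongr
              exact (le_abs_self _).trans (abs_im_le_norm z)
          _ ≤ ‖z‖ ^ (1 : ℝ) := Real.rpow_le_rpow_of_exponent_le hz1 (by norm_num)
          _ = ‖z‖ := Real.rpow_one _
      have h4 : ‖F z‖ ≤ (M + 2 * ‖k‖) * z.im ^ (-(1 / 2) : ℝ) := by
        calc ‖F z‖ ≤ ‖G z‖ + ‖k / (z - conj w)‖ := norm_sub_le _ _
          _ ≤ M * z.im ^ (-(1 / 2) : ℝ) + ‖k‖ / (‖z‖ / 2) := by
              rw [norm_div]
              gcongr
              exact hM z hz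
          _ = M * z.im ^ (-(1 / 2) : ℝ) + 2 * ‖k‖ * (1 / ‖z‖) := by ring
          _ ≤ M * z.im ^ (-(1 / 2) : ℝ) + 2 * ‖k‖ * z.im ^ (-(1 / 2) : ℝ) := by gcongr
          _ = _ := by ring
      rw [hslope z hzne, norm_div]
      calc ‖F z‖ / ‖z - w‖ ≤ ‖F z‖ / (‖z‖ / 2) := by gcongr
        _ ≤ (M + 2 * ‖k‖) * z.im ^ (-(1 / 2) : ℝ) / (‖z‖ / 2) := by gcongr
        _ = _ := by ring
  simp only [hsplit] at h0
  rw [integral_sub hGi hki, sub_eq_zero, integral_const_mul, integral_complex_ofReal, hi2] at h0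
  rw [h0, hk, Complex.sub_conj]
  have : (w.im : ℂ) ≠ 0 := by exact_mod_cast hw'.ne'
  push_cast
  field_simp

/-! ### Calculus of mean type and bounded type. -/

theorem isOpen_upperHalf : IsOpen upperHalf := isOpen_lt continuous_const continuous_im

theorem isPreconnected_upperHalf : IsPreconnected upperHalf :=
  (convex_halfSpace_im_gt 0).isPreconnected

theorem I_mul_mem_upperHalf {y : ℝ} (hy : 0 < y) : I * (y : ℂ) ∈ upperHalf := by
  simpa [upperHalf] using hy

/-- Replaces the extended-real `limsup` by the subexponential bound that Phragmén-Lindelöf consumes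
and that is easily checked for sums and multiples. -/
theorem meanType_le_zero_iff {f : ℂ → ℂ} :
    meanType f ≤ 0 ↔ ∀ ε > 0, ∀ᶠ y : ℝ in atTop, ‖f (I * y)‖ ≤ Real.exp (ε * y) := by
  have key : ∀ {ε y : ℝ}, 0 < y → (ENNReal.log ‖f (I * (y : ℂ))‖ₑ / (y : EReal) ≤ (ε : EReal) ↔
      ‖f (I * y)‖ ≤ Real.exp (ε * y)) := by
    intro ε y hy
    rw [EReal.div_le_iff_le_mul (by exact_mod_cast hy) (EReal.coe_ne_top y), ← ofReal_norm,
      ENNReal.log_ofReal, ← EReal.coe_mul]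
    split_ifs with h
    · simp only [bot_le, true_iff]
      exact h.trans (Real.exp_pos _).le
    · rw [EReal.coe_le_coe_iff, Real.log_le_iff_le_exp (not_le.1 h), mul_comm y ε]
  constructor
  · intro h ε hε
    have h1 : meanType f < (ε : EReal) := lt_of_le_of_lt h (by exact_mod_cast hε)
    filter_upwards [eventually_lt_of_limsup_lt h1, eventually_gt_atTop 0] with y hy hy0
    exact (key hy0).1 hy.le
  · intro h
    refine EReal.le_of_forall_lt_iff_le.1 fun ε hε => ?_
    refine limsup_le_of_le (by isBoundedDefault) ?_
    filter_upwards [h ε (by exact_mod_cast hε), eventually_gt_atTop 0] with y hy hy0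
    exact (key hy0).2 hy

theorem eventually_const_le_exp (c : ℝ) {ε : ℝ} (hε : 0 < ε) :
    ∀ᶠ y : ℝ in atTop, c ≤ Real.exp (ε * y) :=
  (Real.tendsto_exp_atTop.comp (tendsto_id.const_mul_atTop hε)).eventually_ge_atTop c

theorem meanType_le_zero_of_congr {f g : ℂ → ℂ} (hf : meanType f ≤ 0)
    (h : ∀ z ∈ upperHalf, ‖g z‖ ≤ ‖f z‖) : meanType g ≤ 0 := by
  rw [meanType_le_zero_iff] at hf ⊢
  intro ε hε
  filter_upwards [hf ε hε, eventually_gt_atTop 0] with y hy hy0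
  exact (h _ (I_mul_mem_upperHalf hy0)).trans hy

theorem meanType_add_le_zero {f g : ℂ → ℂ} (hf : meanType f ≤ 0) (hg : meanType g ≤ 0) :
    meanType (fun z => f z + g z) ≤ 0 := by
  rw [meanType_le_zero_iff] at *
  intro ε hε
  filter_upwards [hf (ε / 2) (half_pos hε), hg (ε / 2) (half_pos hε),
    eventually_const_le_exp 2 (half_pos hε)] with y h1 h2 h3
  calc ‖f (I * y) + g (I * y)‖ ≤ Real.exp (ε / 2 * y) + Real.exp (ε / 2 * y) :=
        (norm_add_le _ _).trans (add_le_add h1 h2)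
    _ = 2 * Real.exp (ε / 2 * y) := by ring
    _ ≤ Real.exp (ε / 2 * y) * Real.exp (ε / 2 * y) := by gcongr
    _ = Real.exp (ε * y) := by rw [← Real.exp_add]; ring_nf

theorem meanType_const_mul_le_zero {f : ℂ → ℂ} (hf : meanType f ≤ 0) (c : ℂ) :
    meanType (fun z => c * f z) ≤ 0 := by
  rw [meanType_le_zero_iff] at *
  intro ε hε
  filter_upwards [hf (ε / 2) (half_pos hε), eventually_const_le_exp ‖c‖ (half_pos hε)]
    with y h1 h2
  rw [norm_mul]
  calc ‖c‖ * ‖f (I * y)‖ ≤ Real.exp (ε / 2 * y) * Real.exp (ε / 2 * y) := by gcongr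
    _ = Real.exp (ε * y) := by rw [← Real.exp_add]; ring_nf

theorem IsBoundedAnalytic.const (c : ℂ) : IsBoundedAnalytic fun _ => c :=
  ⟨differentiableOn_const _, ‖c‖, fun _ _ => le_rfl⟩

theorem IsBoundedAnalytic.add {f g : ℂ → ℂ} (hf : IsBoundedAnalytic f)
    (hg : IsBoundedAnalytic g) : IsBoundedAnalytic fun z => f z + g z := by
  obtain ⟨hf, C, hC⟩ := hf
  obtain ⟨hg, D, hD⟩ := hg
  exact ⟨hf.add hg, C + D, fun z hz => (norm_add_le _ _).trans (add_le_add (hC z hz) (hD z hz))⟩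

theorem IsBoundedAnalytic.mul {f g : ℂ → ℂ} (hf : IsBoundedAnalytic f)
    (hg : IsBoundedAnalytic g) : IsBoundedAnalytic fun z => f z * g z := by
  obtain ⟨hf, C, hC⟩ := hf
  obtain ⟨hg, D, hD⟩ := hg
  refine ⟨hf.mul hg, C * D, fun z hz => ?_⟩
  rw [norm_mul]
  exact mul_le_mul (hC z hz) (hD z hz) (norm_nonneg _) ((norm_nonneg _).trans (hC z hz))

theorem IsBoundedType.congr {f g : ℂ → ℂ} (hf : IsBoundedType f)
    (h : ∀ z ∈ upperHalf, g z = f z) : IsBoundedType g := by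
  obtain ⟨hd, p, q, hp, hq, hq0, hpq⟩ := hf
  exact ⟨hd.congr h, p, q, hp, hq, hq0, fun z hz => by rw [h z hz, hpq z hz]⟩

theorem IsBoundedType.mul_bounded {f b : ℂ → ℂ} (hf : IsBoundedType f)
    (hb : IsBoundedAnalytic b) : IsBoundedType fun z => f z * b z := by
  obtain ⟨hd, p, q, hp, hq, hq0, hpq⟩ := hf
  exact ⟨hd.mul hb.1, fun z => p z * b z, q, hp.mul hb, hq, hq0,
    fun z hz => by simp only [← hpq z hz]; ring⟩

theorem IsBoundedType.const_mul {f : ℂ → ℂ} (hf : IsBoundedType f) (c : ℂ) :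
    IsBoundedType fun z => c * f z :=
  (hf.mul_bounded (IsBoundedAnalytic.const c)).congr fun _ _ => mul_comm _ _

theorem IsBoundedType.add {f g : ℂ → ℂ} (hf : IsBoundedType f) (hg : IsBoundedType g) :
    IsBoundedType fun z => f z + g z := by
  obtain ⟨hd, p, q, hp, hq, ⟨a, ha, hqa⟩, hpq⟩ := hf
  obtain ⟨hd', p', q', hp', hq', ⟨b, hb, hqb⟩, hpq'⟩ := hg
  refine ⟨hd.add hd', fun z => p z * q' z + p' z * q z, fun z => q z * q' z,
    (hp.mul hq').add (hp'.mul hq), hq.mul hq', ?_, fun z hz => ?_⟩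
  -- The product of the denominators is not identically zero by the identity theorem on the
  -- connected half-plane.
  · by_contra! h
    rcases AnalyticOnNhd.eq_zero_or_eq_zero_of_mul_eq_zero
      (hq.1.analyticOnNhd isOpen_upperHalf) (hq'.1.analyticOnNhd isOpen_upperHalf) h
      isPreconnected_upperHalf with h | h
    · exact hqa (h a ha)
    · exact hqb (h b hb)
  · simp only [← hpq z hz, ← hpq' z hz]
    ring

/-! ### Hermite-Biehler functions and closure properties of `H(E)`. -/

theorem starFn_ofReal (f : ℂ → ℂ) (t : ℝ) : starFn f t = conj (f t) := by
  rw [starFn, conj_ofReal]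

theorem starFn_starFn (f : ℂ → ℂ) : starFn (starFn f) = f := by
  funext z
  simp [starFn]

theorem differentiable_starFn {f : ℂ → ℂ} (hf : Differentiable ℂ f) :
    Differentiable ℂ (starFn f) := by
  intro z
  have h := (hf (conj z)).conj_conj
  rwa [conj_conj] at h

theorem IsHermiteBiehler.ne_zero {E : ℂ → ℂ} (hE : IsHermiteBiehler E) {z : ℂ}
    (hz : z ∈ upperHalf) : E z ≠ 0 :=
  norm_pos_iff.1 ((norm_nonneg _).trans_lt (hE.norm_lt z hz))

theorem IsHermiteBiehler.mul {E F : ℂ → ℂ} (hE : IsHermiteBiehler E) (hF : IsHermiteBiehler F) :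
    IsHermiteBiehler fun z => E z * F z :=
  ⟨hE.entire.mul hF.entire, fun z hz => by
    rw [norm_mul, norm_mul]
    exact mul_lt_mul'' (hE.norm_lt z hz) (hF.norm_lt z hz) (norm_nonneg _) (norm_nonneg _)⟩

theorem IsHermiteBiehler.norm_starFn_div_le {E : ℂ → ℂ} (hE : IsHermiteBiehler E) {z : ℂ}
    (hz : z ∈ upperHalf) : ‖starFn E z / E z‖ ≤ 1 := by
  rw [norm_div, starFn, norm_conj]
  exact div_le_one_of_le₀ (hE.norm_lt z hz).le (norm_nonneg _)

theorem IsHermiteBiehler.isBoundedAnalytic_starFn_div {E : ℂ → ℂ} (hE : IsHermiteBiehler E) :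
    IsBoundedAnalytic fun z => starFn E z / E z :=
  ⟨(differentiable_starFn hE.entire).differentiableOn.div hE.entire.differentiableOn
    fun _ hz => hE.ne_zero hz, 1, fun _ hz => hE.norm_starFn_div_le hz⟩

theorem IsHermiteBiehler.eventually_ne_zero {E : ℂ → ℂ} (hE : IsHermiteBiehler E) (z : ℂ) :
    ∀ᶠ w in 𝓝[≠] z, E w ≠ 0 := by
  have hI : I ∈ upperHalf := by simp [upperHalf]
  have h := (hE.entire.differentiableOn.analyticOnNhd isOpen_univ).preimage_zero_mem_codiscrete
    (hE.ne_zero hI)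
  rw [mem_codiscrete] at h
  have h1 := h z
  rw [disjoint_principal_right, compl_compl] at h1
  exact h1

/-- Real zeros may occur, but they are isolated and hence a null set; integrals over the line ignore
them. -/
theorem IsHermiteBiehler.ae_ne_zero {E : ℂ → ℂ} (hE : IsHermiteBiehler E) :
    ∀ᵐ t : ℝ, E t ≠ 0 := by
  have h : {t : ℝ | E t ≠ 0} ∈ codiscrete ℝ := by
    rw [mem_codiscrete]
    intro t
    rw [disjoint_principal_right, compl_compl]
    have h1 : Tendsto (fun s : ℝ => (s : ℂ)) (𝓝[≠] t) (𝓝[≠] (t : ℂ)) :=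
      continuous_ofReal.continuousAt.continuousWithinAt.tendsto_nhdsWithin
        fun s hs => by simpa using hs
    exact h1.eventually (hE.eventually_ne_zero t)
  have := ae_restrict_le_codiscreteWithin (μ := (volume : Measure ℝ)) MeasurableSet.univ h
  rwa [Measure.restrict_univ] at this

theorem MemH.star {E f : ℂ → ℂ} (hf : MemH E f) : MemH E (starFn f) where
  entire := differentiable_starFn hf.entire
  sq_integrable := by
    refine hf.sq_integrable.congr (Eventually.of_forall fun t => ?_)
    simp only [norm_div, starFn_ofReal, norm_conj]
  boundedType := hf.boundedType_star
  meanType_le := hf.meanType_star_le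
  boundedType_star := by simpa only [starFn_starFn] using hf.boundedType
  meanType_star_le := by simpa only [starFn_starFn] using hf.meanType_le

theorem measurable_div_ofReal {E f : ℂ → ℂ} (hE : Differentiable ℂ E) (hf : Differentiable ℂ f) :
    Measurable fun t : ℝ => f t / E t :=
  (hf.continuous.comp continuous_ofReal).measurable.div
    (hE.continuous.comp continuous_ofReal).measurable

theorem MemH.memLp {E f : ℂ → ℂ} (hE : IsHermiteBiehler E) (hf : MemH E f) :
    MemLp (fun t : ℝ => f t / E t) 2 volume :=
  (memLp_two_iff_integrable_sq_norm
    (measurable_div_ofReal hE.entire hf.entire).aestronglyMeasurable).2 hf.sq_integrable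

theorem sq_integrable_of_memLp {E f : ℂ → ℂ} (h : MemLp (fun t : ℝ => f t / E t) 2 volume) :
    Integrable fun t : ℝ => ‖f t / E t‖ ^ 2 :=
  (memLp_two_iff_integrable_sq_norm h.1).1 h

theorem MemH.add {E f g : ℂ → ℂ} (hE : IsHermiteBiehler E) (hf : MemH E f) (hg : MemH E g) :
    MemH E fun z => f z + g z where
  entire := hf.entire.add hg.entire
  sq_integrable := sq_integrable_of_memLp (E := E) (f := fun z => f z + g z)
    (((hf.memLp hE).add (hg.memLp hE)).ae_eq
      (Eventually.of_forall fun t => (add_div (f t) (g t) (E t)).symm))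
  boundedType := by simpa only [add_div] using hf.boundedType.add hg.boundedType
  meanType_le := by simpa only [add_div] using meanType_add_le_zero hf.meanType_le hg.meanType_le
  boundedType_star := by
    simpa only [starFn, map_add, add_div] using hf.boundedType_star.add hg.boundedType_star
  meanType_star_le := by
    simpa only [starFn, map_add, add_div] using
      meanType_add_le_zero hf.meanType_star_le hg.meanType_star_le

theorem MemH.const_mul {E f : ℂ → ℂ} (hE : IsHermiteBiehler E) (hf : MemH E f) (c : ℂ) :
    MemH E fun z => c * f z where
  entire := hf.entire.const_mul c
  sq_integrable := sq_integrable_of_memLp (E := E) (f := fun z => c * f z)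
    (((hf.memLp hE).const_mul c).ae_eq
      (Eventually.of_forall fun t => (mul_div_assoc c (f t) (E t)).symm))
  boundedType := by simpa only [mul_div_assoc] using hf.boundedType.const_mul c
  meanType_le := by
    simpa only [mul_div_assoc] using meanType_const_mul_le_zero hf.meanType_le c
  boundedType_star := by
    simpa only [starFn, map_mul, mul_div_assoc] using hf.boundedType_star.const_mul (conj c)
  meanType_star_le := by
    simpa only [starFn, map_mul, mul_div_assoc] using
      meanType_const_mul_le_zero hf.meanType_star_le (conj c)

theorem MemH.sub_sum {E f : ℂ → ℂ} (hE : IsHermiteBiehler E) (hf : MemH E f) {ι : Type*}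
    (s : Finset ι) {u : ι → ℂ → ℂ} (hu : ∀ n, MemH E (u n)) :
    MemH E fun z => f z - ∑ n ∈ s, u n z := by
  classical
  induction s using Finset.induction_on with
  | empty => simpa using hf
  | insert n s hn ih =>
    have h := ih.add hE ((hu n).const_mul hE (-1))
    refine (congrArg (MemH E) (funext fun z => ?_)).mp h
    rw [Finset.sum_insert hn]
    ring

/-- Multiplication by `F` maps `H(E)` into `H(EF)`. -/
theorem MemH.mul_left {E F f : ℂ → ℂ} (hF : IsHermiteBiehler F) (hf : MemH E f) :
    MemH (fun z => E z * F z) fun z => F z * f z := by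
  have h1 : ∀ z ∈ upperHalf, F z * f z / (E z * F z) = f z / E z := fun z hz => by
    rw [mul_comm (F z), mul_div_mul_right _ _ (hF.ne_zero hz)]
  -- The star produces the extra factor `F* / F`, analytic and bounded by `1` in the upper
  -- half-plane by the Hermite-Biehler inequality.
  have h2 : ∀ z, starFn (fun z => F z * f z) z / (E z * F z) =
      starFn f z / E z * (starFn F z / F z) := fun z => by
    simp only [starFn, map_mul]
    rw [div_mul_div_comm, mul_comm (conj (F _))]
  refine ⟨hF.entire.mul hf.entire, ?_, hf.boundedType.congr h1,
    meanType_le_zero_of_congr hf.meanType_le fun z hz => by rw [h1 z hz], ?_, ?_⟩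
  · refine hf.sq_integrable.congr ?_
    filter_upwards [hF.ae_ne_zero] with t ht
    rw [mul_comm (F t), mul_div_mul_right _ _ ht]
  · exact (hf.boundedType_star.mul_bounded hF.isBoundedAnalytic_starFn_div).congr fun z _ => h2 z
  · refine meanType_le_zero_of_congr hf.meanType_star_le fun z hz => ?_
    rw [h2, norm_mul]
    exact mul_le_of_le_one_right (norm_nonneg _) (hF.norm_starFn_div_le hz)

/-! ### Boundary behaviour of `f / E` on the real line. -/

/-- If `f / E` is square integrable near a real point, it is bounded near it. -/
theorem meromorphicOrderAt_div_nonneg {E f : ℂ → ℂ} (hE : IsHermiteBiehler E) (hf : MemH E f)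
    (x : ℝ) : 0 ≤ meromorphicOrderAt (fun z => f z / E z) x := by
  have hmer : MeromorphicAt (fun z => f z / E z) (x : ℂ) :=
    (hf.entire.analyticAt _).meromorphicAt.fun_div (hE.entire.analyticAt _).meromorphicAt
  by_contra! hneg
  have hne : meromorphicOrderAt (fun z => f z / E z) x ≠ ⊤ := hneg.ne_top
  obtain ⟨n, hn⟩ := WithTop.ne_top_iff_exists.1 hne
  rw [← hn] at hneg
  have hn0 : n < 0 := by exact_mod_cast hneg
  obtain ⟨g, hg, hgx, hfg⟩ := (meromorphicOrderAt_eq_int_iff hmer).1 hn.symm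
  have hreal : Tendsto (fun s : ℝ => (s : ℂ)) (𝓝[≠] x) (𝓝[≠] (x : ℂ)) :=
    continuous_ofReal.continuousAt.continuousWithinAt.tendsto_nhdsWithin
      fun s hs => by simpa using hs
  have hgx' : 0 < ‖g x‖ := norm_pos_iff.2 hgx
  have hgev : ∀ᶠ z in 𝓝[≠] (x : ℂ), ‖g x‖ / 2 < ‖g z‖ :=
    (hg.continuousAt.norm.eventually_const_lt (by linarith)).filter_mono nhdsWithin_le_nhds
  have hnear : ∀ᶠ s : ℝ in 𝓝[≠] x, |s - x| < 1 :=
    ((continuous_abs.comp (continuous_id.sub continuous_const)).tendsto' x 0 (by simp)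
      |>.eventually_lt_const one_pos).filter_mono nhdsWithin_le_nhds
  -- A pole of order at least one makes `|f / E|²` at least a constant times `|s - x|⁻²`, hence
  -- dominates `|s - x|⁻¹`, which is not integrable at `x`.
  have hO : (fun s : ℝ => (s - x)⁻¹) =O[𝓝[≠] x] fun s : ℝ => ‖f s / E s‖ ^ 2 := by
    refine Asymptotics.IsBigO.of_bound ((‖g x‖ / 2) ^ 2)⁻¹ ?_
    filter_upwards [hreal.eventually hfg, hreal.eventually hgev, hnear, self_mem_nhdsWithin]
      with s h1 h2 h3 h4
    have h5 : 0 < |s - x| := abs_pos.2 (sub_ne_zero.2 h4)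
    rw [h1, norm_smul, norm_zpow, ← ofReal_sub, norm_real, norm_inv, Real.norm_eq_abs,
      Real.norm_of_nonneg (by positivity), mul_pow]
    have h6 : |s - x|⁻¹ ≤ (|s - x| ^ n) ^ 2 := by
      rw [← zpow_natCast, ← zpow_mul, ← zpow_neg_one]
      exact zpow_le_zpow_right_of_le_one₀ h5 h3.le (by push_cast; omega)
    rw [inv_mul_eq_div, le_div_iff₀ (by positivity)]
    gcongr
  exact not_intervalIntegrable_of_sub_inv_isBigO_punctured hO (a := x) (b := x + 1)
    (by linarith) (by simp) hf.sq_integrable.intervalIntegrable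

/-- For `f` in `H(E)` the quotient `f / E` extends continuously to the closed upper half-plane. -/
theorem MemH.exists_extension {E f : ℂ → ℂ} (hE : IsHermiteBiehler E) (hf : MemH E f) :
    ∃ G : ℂ → ℂ, ContinuousOn G {z | 0 ≤ z.im} ∧ (∀ z, E z ≠ 0 → G z = f z / E z) ∧
      ∀ t : ℝ, G t * E t = f t := by
  have hmer : MeromorphicOn (fun z => f z / E z) Set.univ := fun z _ =>
    (hf.entire.analyticAt _).meromorphicAt.fun_div (hE.entire.analyticAt _).meromorphicAt
  -- The normal form fills in the removable singularities at real zeros of `E`, where the pointwise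
  -- quotient has the value `0`.
  set G := toMeromorphicNFOn (fun z => f z / E z) Set.univ with hG
  have hGE : ∀ z, E z ≠ 0 → G z = f z / E z := by
    intro z hz
    have han : AnalyticAt ℂ (fun z => f z / E z) z :=
      (hf.entire.analyticAt _).fun_div (hE.entire.analyticAt _) hz
    rw [hG, toMeromorphicNFOn_eq_toMeromorphicNFAt hmer (Set.mem_univ z),
      toMeromorphicNFAt_eq_self.2 han.meromorphicNFAt]
  have hreal : ∀ x : ℝ, AnalyticAt ℂ G x := by
    intro x
    have h1 := meromorphicNFOn_toMeromorphicNFOn (fun z => f z / E z) Set.univ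
      (Set.mem_univ (x : ℂ))
    rw [← h1.meromorphicOrderAt_nonneg_iff_analyticAt,
      meromorphicOrderAt_toMeromorphicNFOn hmer (Set.mem_univ _)]
    exact meromorphicOrderAt_div_nonneg hE hf x
  refine ⟨G, fun z hz => ?_, hGE, fun t => ?_⟩
  · rcases (show 0 ≤ z.im from hz).eq_or_lt with h | h
    · have hz' : z = (z.re : ℂ) := Complex.ext (by simp) (by simp [← h])
      rw [hz']
      exact (hreal _).continuousAt.continuousWithinAt
    · have hz0 : E z ≠ 0 := hE.ne_zero h
      have han : ContinuousAt (fun z => f z / E z) z :=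
        (hf.entire.continuous.continuousAt).div (hE.entire.continuous.continuousAt) hz0
      refine (han.congr ?_).continuousWithinAt
      filter_upwards [hE.entire.continuous.continuousAt.eventually_ne hz0] with w hw
      exact (hGE w hw).symm
  · have h1 : Tendsto (fun z => G z * E z) (𝓝[≠] (t : ℂ)) (𝓝 (G t * E t)) :=
      ((hreal t).continuousAt.mul hE.entire.continuous.continuousAt).tendsto.mono_left
        nhdsWithin_le_nhds
    have h2 : Tendsto f (𝓝[≠] (t : ℂ)) (𝓝 (f t)) :=
      hf.entire.continuous.continuousAt.tendsto.mono_left nhdsWithin_le_nhds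
    refine tendsto_nhds_unique h1 (h2.congr' ?_)
    filter_upwards [hE.eventually_ne_zero t] with z hz
    rw [hGE z hz, div_mul_cancel₀ _ hz]

theorem normH_sq (E f : ℂ → ℂ) : normH E f ^ 2 = ∫ t : ℝ, ‖f t / E t‖ ^ 2 :=
  Real.sq_sqrt (integral_nonneg fun _ => by positivity)

theorem normH_nonneg (E f : ℂ → ℂ) : 0 ≤ normH E f := Real.sqrt_nonneg _

theorem normH_starFn (E f : ℂ → ℂ) : normH E (starFn f) = normH E f := by
  simp only [normH, norm_div, starFn_ofReal, norm_conj]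

/-- The extension of `f / E` to the closed half-plane satisfies the `H²` estimates. -/
theorem MemH.exists_hardy_extension {E f : ℂ → ℂ} (hE : IsHermiteBiehler E) (hf : MemH E f) :
    ∃ G : ℂ → ℂ, ContinuousOn G {z | 0 ≤ z.im} ∧ DifferentiableOn ℂ G upperHalf ∧
      (∀ z, E z ≠ 0 → G z = f z / E z) ∧ (∀ t : ℝ, G t * E t = f t) ∧
      MemLp (fun t : ℝ => G t) 2 volume ∧
      (∀ z ∈ upperHalf, ‖G z‖ ^ 2 ≤ normH E f ^ 2 / (Real.pi * z.im)) := by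
  obtain ⟨G, hGc, hGE, hGt⟩ := hf.exists_extension hE
  have hGU : ∀ z ∈ upperHalf, G z = f z / E z := fun z hz => hGE z (hE.ne_zero hz)
  have hae : (fun t : ℝ => f t / E t) =ᵐ[volume] fun t : ℝ => G t := by
    filter_upwards [hE.ae_ne_zero] with t ht
    exact (hGE t ht).symm
  have hL2 : MemLp (fun t : ℝ => G t) 2 volume := (hf.memLp hE).ae_eq hae
  have hbt : IsBoundedType G := hf.boundedType.congr hGU
  refine ⟨G, hGc, hbt.1, hGE, hGt, hL2, fun z hz => ?_⟩
  have h := norm_sq_le_of_boundedType hGc hbt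
    (meanType_le_zero_iff.1
      (meanType_le_zero_of_congr hf.meanType_le fun w hw => by rw [hGU w hw]))
    ((memLp_two_iff_integrable_sq_norm hL2.1).1 hL2) hz
  refine h.trans (le_of_eq ?_)
  rw [normH_sq]
  congr 1
  refine integral_congr_ae ?_
  filter_upwards [hae] with t ht
  rw [ht]

theorem norm_le_rpow_of_sq_le {x y N : ℝ} (hy : 0 < y) (hN : 0 ≤ N)
    (h : x ^ 2 ≤ N ^ 2 / (Real.pi * y)) : x ≤ N * y ^ (-(1 / 2) : ℝ) := by
  refine le_of_sq_le_sq ?_ (by positivity)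
  rw [mul_pow, ← Real.rpow_natCast (y ^ _), ← Real.rpow_mul hy.le]
  norm_num
  rw [Real.rpow_neg_one, ← div_eq_mul_inv]
  refine h.trans ?_
  gcongr
  nlinarith [Real.pi_gt_three]

/-- Cauchy's formulas for `f / E`. -/
theorem MemH.cauchy {E f : ℂ → ℂ} (hE : IsHermiteBiehler E) (hf : MemH E f) {w : ℂ}
    (hw : w ∈ upperHalf) :
    ∫ t : ℝ, f t / E t / (t - w) = 2 * Real.pi * I * (f w / E w) ∧
      ∫ t : ℝ, f t / E t / (t - conj w) = 0 := by
  obtain ⟨G, hGc, hGd, hGE, -, hL2, hle⟩ := hf.exists_hardy_extension hE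
  have hM : ∀ z ∈ upperHalf, ‖G z‖ ≤ normH E f * z.im ^ (-(1 / 2) : ℝ) := fun z hz =>
    norm_le_rpow_of_sq_le hz (normH_nonneg _ _) (hle z hz)
  have hcongr : ∀ c : ℂ, ∫ t : ℝ, f t / E t / (t - c) = ∫ t : ℝ, G t / (t - c) := fun c => by
    refine integral_congr_ae ?_
    filter_upwards [hE.ae_ne_zero] with t ht
    rw [hGE t ht]
  rw [hcongr, hcongr, ← hGE w (hE.ne_zero hw)]
  exact ⟨integral_div_sub_eq hGc hGd hL2 hM hw, integral_div_sub_conj_eq_zero hGc hGd hL2 hM hw⟩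

theorem MemH.eq_zero_of_real_zero {E f : ℂ → ℂ} (hE : IsHermiteBiehler E) (hf : MemH E f) {t : ℝ}
    (ht : E t = 0) : f t = 0 := by
  obtain ⟨G, -, -, hGt⟩ := hf.exists_extension hE
  rw [← hGt t, ht, mul_zero]

/-- Point evaluations off the real line are bounded on `H(E)`. -/
theorem MemH.norm_le_of_mem_upperHalf {E f : ℂ → ℂ} (hE : IsHermiteBiehler E) (hf : MemH E f)
    {z : ℂ} (hz : z ∈ upperHalf) :
    ‖f z‖ ≤ ‖E z‖ * z.im ^ (-(1 / 2) : ℝ) * normH E f := by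
  obtain ⟨G, -, -, hGE, -, -, hle⟩ := hf.exists_hardy_extension hE
  have h := norm_le_rpow_of_sq_le hz (normH_nonneg _ _) (hle z hz)
  have hEz := hE.ne_zero hz
  rw [hGE z hEz, norm_div, div_le_iff₀ (norm_pos_iff.2 hEz)] at h
  exact h.trans (le_of_eq (by ring))

/-! ### The kernel at real points as an element of `H(E)`. -/

/-- For real `w` the numerator vanishes at `z = w`, so a divided difference covers both cases of the
definition and shows that the kernel is entire. -/
theorem kernel_eq_dslope (E : ℂ → ℂ) (w : ℝ) (z : ℂ) :
    kernel E w z = -dslope (fun ζ => conj (E w) * E ζ - E w * starFn E ζ) w z /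
      (2 * Real.pi * I) := by
  rw [kernel]
  simp only [conj_ofReal]
  split_ifs with h
  · rw [h, dslope_same]
  · rw [dslope_of_ne _ h, slope_def_field, starFn_ofReal]
    have h1 : (w : ℂ) - z ≠ 0 := sub_ne_zero.2 (Ne.symm h)
    have h2 : z - w ≠ 0 := sub_ne_zero.2 h
    have h3 : (2 * Real.pi * I : ℂ) ≠ 0 := two_pi_I_ne_zero
    rw [div_eq_div_iff (mul_ne_zero h3 h1) h3, ← mul_left_inj' h2]
    have h4 : -((conj (E w) * E z - E w * starFn E z - (conj (E w) * E w - E w * conj (E w))) /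
        (z - w)) * (2 * Real.pi * I * (w - z)) * (z - w) =
        -(conj (E w) * E z - E w * starFn E z - (conj (E w) * E w - E w * conj (E w))) *
          (2 * Real.pi * I * (w - z)) := by
      field_simp
    rw [h4]
    ring

theorem kernel_of_ne (E : ℂ → ℂ) {w : ℝ} {z : ℂ} (h : z ≠ w) :
    kernel E w z = (conj (E w) * E z - E w * starFn E z) / (2 * Real.pi * I * (w - z)) := by
  rw [kernel]
  simp only [conj_ofReal]
  rw [if_neg h]

theorem kernel_of_eq_zero {E : ℂ → ℂ} {w : ℝ} (h : E w = 0) (z : ℂ) : kernel E w z = 0 := by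
  have : (fun ζ => conj (E w) * E ζ - E w * starFn E ζ) = fun _ => 0 := by
    funext ζ
    simp [h]
  rw [kernel_eq_dslope, this]
  simp [dslope, slope, Function.update_apply]

theorem differentiable_kernel {E : ℂ → ℂ} (hE : Differentiable ℂ E) (w : ℝ) :
    Differentiable ℂ fun z => kernel E w z := by
  have h1 : Differentiable ℂ (fun ζ => conj (E w) * E ζ - E w * starFn E ζ) :=
    (hE.const_mul _).sub ((differentiable_starFn hE).const_mul _)
  have h2 := (differentiableOn_dslope (c := (w : ℂ)) univ_mem).2 h1.differentiableOn
  simp only [kernel_eq_dslope]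
  exact (differentiableOn_univ.1 h2).neg.div_const _

/-- Under the star both numerator and denominator change sign. The starred conditions in `MemH` thus
reduce to the unstarred ones. -/
theorem starFn_kernel {E : ℂ → ℂ} (hE : Differentiable ℂ E) (w : ℝ) :
    starFn (kernel E w) = kernel E w := by
  have hoff : ∀ z, z ≠ (w : ℂ) → starFn (kernel E w) z = kernel E w z := by
    intro z hz
    have hz' : conj z ≠ (w : ℂ) := fun h => hz (by rw [← conj_conj z, h, conj_ofReal])
    rw [starFn, kernel_of_ne E hz', kernel_of_ne E hz]
    have h1 : (w : ℂ) - z ≠ 0 := sub_ne_zero.2 (Ne.symm hz)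
    have h2 : (Real.pi : ℂ) ≠ 0 := by exact_mod_cast Real.pi_ne_zero
    simp only [starFn, map_div₀, map_sub, map_mul, conj_conj, conj_ofReal, conj_I, map_ofNat]
    field_simp
    ring
  have hk := differentiable_kernel hE w
  have h1 : Tendsto (starFn (kernel E w)) (𝓝[≠] (w : ℂ)) (𝓝 (starFn (kernel E w) w)) :=
    (differentiable_starFn hk).continuous.continuousAt.tendsto.mono_left nhdsWithin_le_nhds
  have h2 : Tendsto (kernel E w) (𝓝[≠] (w : ℂ)) (𝓝 (kernel E w w)) :=
    hk.continuous.continuousAt.tendsto.mono_left nhdsWithin_le_nhds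
  funext z
  rcases eq_or_ne z w with rfl | hz
  · refine tendsto_nhds_unique h1 (h2.congr' ?_)
    filter_upwards [self_mem_nhdsWithin] with z hz
    exact (hoff z hz).symm
  · exact hoff z hz

/-- The bound on `E* / E` holds both in the upper half-plane and on the real line, so one estimate
serves mean type and square integrability. -/
theorem norm_kernel_div_le {E : ℂ → ℂ} {w : ℝ} {z : ℂ} (hz : z ≠ w)
    (hE : ‖starFn E z / E z‖ ≤ 1) : ‖kernel E w z / E z‖ ≤ ‖E w‖ / ‖(w : ℂ) - z‖ := by
  rcases eq_or_ne (E z) 0 with h0 | h0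
  · rw [h0, div_zero, norm_zero]
    positivity
  have h1 : 0 < ‖(w : ℂ) - z‖ := norm_pos_iff.2 (sub_ne_zero.2 (Ne.symm hz))
  have h2 : kernel E w z / E z =
      (conj (E w) - E w * (starFn E z / E z)) / (2 * Real.pi * I * (w - z)) := by
    rw [kernel_of_ne E hz, div_right_comm, sub_div, mul_div_assoc, div_self h0, mul_one,
      mul_div_assoc]
  have h3 : ‖conj (E w) - E w * (starFn E z / E z)‖ ≤ 2 * ‖E w‖ := by
    refine (norm_sub_le _ _).trans ?_
    rw [norm_conj, norm_mul]
    nlinarith [norm_nonneg (E w)]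
  rw [h2, norm_div, norm_mul, norm_mul, norm_mul, norm_I, mul_one, norm_real,
    Real.norm_of_nonneg Real.pi_pos.le, norm_ofNat, div_le_div_iff₀ (by positivity) h1]
  calc _ ≤ 2 * ‖E w‖ * ‖(w : ℂ) - z‖ := by gcongr
    _ ≤ 2 * Real.pi * (‖E w‖ * ‖(w : ℂ) - z‖) := by
        have : 0 ≤ ‖E w‖ * ‖(w : ℂ) - z‖ := by positivity
        nlinarith [Real.pi_gt_three]
    _ = _ := by ring

theorem norm_starFn_div_ofReal_le (E : ℂ → ℂ) (t : ℝ) : ‖starFn E t / E t‖ ≤ 1 := by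
  rw [norm_div, starFn_ofReal, norm_conj]
  exact div_self_le_one _

theorem isBoundedType_kernel_div {E : ℂ → ℂ} (hE : IsHermiteBiehler E) (w : ℝ) :
    IsBoundedType fun z => kernel E w z / E z := by
  have hI : ∀ z ∈ upperHalf, max 1 ‖z‖ ≤ ‖z + I‖ := by
    intro z hz
    have hz' : 0 < z.im := hz
    have h1 : ‖z + I‖ ^ 2 = ‖z‖ ^ 2 + 2 * z.im + 1 := by
      rw [← normSq_eq_norm_sq, ← normSq_eq_norm_sq, normSq_apply, normSq_apply]
      simp
      ring
    refine max_le ?_ ?_ <;>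
    · refine le_of_sq_le_sq ?_ (norm_nonneg _)
      nlinarith [sq_nonneg ‖z‖]
  have hI0 : ∀ z ∈ upperHalf, z + I ≠ 0 := fun z hz =>
    norm_pos_iff.1 (one_pos.trans_le ((le_max_left _ _).trans (hI z hz)))
  -- The denominator `w - z` is unbounded; dividing numerator and denominator by `z + I` makes both
  -- bounded.
  have hinv : IsBoundedAnalytic fun z => (z + I)⁻¹ := by
    refine ⟨DifferentiableOn.inv (by fun_prop) hI0, 1, fun z hz => ?_⟩
    rw [norm_inv]
    exact inv_le_one_of_one_le₀ ((le_max_left _ _).trans (hI z hz))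
  have hq : IsBoundedAnalytic fun z => (w - z) * (z + I)⁻¹ := by
    refine ⟨DifferentiableOn.mul (by fun_prop) hinv.1, |w| + 1, fun z hz => ?_⟩
    rw [norm_mul, norm_inv, ← div_eq_mul_inv, div_le_iff₀ (norm_pos_iff.2 (hI0 z hz))]
    refine (norm_sub_le _ _).trans ?_
    rw [norm_real, Real.norm_eq_abs]
    have h1 := (le_max_left 1 ‖z‖).trans (hI z hz)
    have h2 := (le_max_right 1 ‖z‖).trans (hI z hz)
    nlinarith [abs_nonneg w]
  refine ⟨(differentiable_kernel hE.entire w).differentiableOn.div hE.entire.differentiableOn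
    fun z hz => hE.ne_zero hz, fun z => (conj (E w) / (2 * Real.pi * I) +
      -(E w / (2 * Real.pi * I)) * (starFn E z / E z)) * (z + I)⁻¹, _, ?_, hq, ?_, ?_⟩
  · exact ((IsBoundedAnalytic.const _).add
      ((IsBoundedAnalytic.const _).mul hE.isBoundedAnalytic_starFn_div)).mul hinv
  · have hII : I ∈ upperHalf := by simp [upperHalf]
    refine ⟨I, hII, mul_ne_zero (sub_ne_zero.2 fun h => ?_) (inv_ne_zero (hI0 I hII))⟩
    have := congrArg im h
    simp at this
  · intro z hz
    have hzw : z ≠ w := by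
      rintro rfl
      simp [upperHalf] at hz
    have h0 := hE.ne_zero hz
    have h1 : (w : ℂ) - z ≠ 0 := sub_ne_zero.2 (Ne.symm hzw)
    have h3 : (2 * Real.pi * I : ℂ) ≠ 0 := two_pi_I_ne_zero
    have h4 := hI0 z hz
    simp only [kernel_of_ne E hzw]
    field_simp
    ring

theorem integrable_sq_kernel_div {E : ℂ → ℂ} (hE : IsHermiteBiehler E) (w : ℝ) :
    Integrable fun t : ℝ => ‖kernel E w t / E t‖ ^ 2 := by
  rcases eq_or_ne (E w) 0 with h0 | h0
  · simp [kernel_of_eq_zero h0]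
  have hk := differentiable_kernel hE.entire w
  have hcont : ContinuousAt (fun t : ℝ => ‖kernel E w t / E t‖ ^ 2) w := by
    have h1 : ContinuousAt (fun z : ℂ => kernel E w z / E z) (w : ℂ) :=
      hk.continuous.continuousAt.div hE.entire.continuous.continuousAt h0
    exact (h1.comp continuous_ofReal.continuousAt).norm.pow 2
  set A := ‖kernel E w w / E w‖ ^ 2 + 1 with hA
  obtain ⟨δ, hδ, hball⟩ := Metric.eventually_nhds_iff.1
    (hcont.eventually_lt_const (show ‖kernel E w w / E w‖ ^ 2 < A by linarith))
  have hA0 : 0 ≤ A := by positivity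
  -- The two summands make `B / ((t - w)² + 1)` a majorant within distance `δ` of `w`, by
  -- continuity, and beyond it, by the decay `‖E w‖ / |t - w|`.
  set B := A * (1 + δ ^ 2) + ‖E w‖ ^ 2 * (1 + (δ ^ 2)⁻¹) with hB
  have hi := (integral_inv_sq_add_sq w one_pos).1.const_mul B
  refine hi.mono' ((measurable_div_ofReal hE.entire hk).norm.pow_const 2).aestronglyMeasurable
    (Eventually.of_forall fun t => ?_)
  rw [Real.norm_of_nonneg (by positivity), ← div_eq_mul_inv, le_div_iff₀ (by positivity), one_pow]
  rcases lt_or_ge |t - w| δ with h | h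
  · have h1 : ‖kernel E w t / E t‖ ^ 2 ≤ A := (hball (by rwa [Real.dist_eq])).le
    have h2 : (t - w) ^ 2 ≤ δ ^ 2 := sq_le_sq' (by linarith [abs_lt.1 h]) (abs_lt.1 h).2.le
    calc _ ≤ A * ((t - w) ^ 2 + 1) := by gcongr
      _ ≤ A * (1 + δ ^ 2) := by
          exact mul_le_mul_of_nonneg_left (by linarith) hA0
      _ ≤ B := by
          rw [hB]
          have : 0 ≤ ‖E w‖ ^ 2 * (1 + (δ ^ 2)⁻¹) := by positivity
          linarith
  · have htw : (t : ℂ) ≠ w := by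
      intro hc
      have : t = w := by exact_mod_cast hc
      rw [this, sub_self, abs_zero] at h
      linarith
    have h1 := norm_kernel_div_le htw (norm_starFn_div_ofReal_le E t)
    have h2 : ‖(w : ℂ) - t‖ = |t - w| := by
      rw [← ofReal_sub, norm_real, Real.norm_eq_abs, abs_sub_comm]
    rw [h2] at h1
    have h3 : δ ^ 2 ≤ (t - w) ^ 2 := by
      rw [← sq_abs (t - w)]
      gcongr
    have h4 : 0 < (t - w) ^ 2 := lt_of_lt_of_le (by positivity) h3
    calc _ ≤ (‖E w‖ / |t - w|) ^ 2 * ((t - w) ^ 2 + 1) := by gcongr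
      _ = ‖E w‖ ^ 2 * (1 + ((t - w) ^ 2)⁻¹) := by
          rw [div_pow, sq_abs, mul_add, mul_add, div_mul_cancel₀ _ h4.ne', mul_one, mul_one,
            div_eq_mul_inv]
      _ ≤ ‖E w‖ ^ 2 * (1 + (δ ^ 2)⁻¹) := by gcongr
      _ ≤ B := by
          rw [hB]
          have : 0 ≤ A * (1 + δ ^ 2) := by positivity
          linarith

/-- The reproducing kernel at a real point belongs to `H(E)`. -/
theorem memH_kernel {E : ℂ → ℂ} (hE : IsHermiteBiehler E) (w : ℝ) :
    MemH E fun z => kernel E w z := by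
  have hmt : meanType (fun z => kernel E w z / E z) ≤ 0 := by
    rw [meanType_le_zero_iff]
    intro ε hε
    filter_upwards [eventually_const_le_exp ‖E w‖ hε, eventually_ge_atTop 1] with y h1 h2
    have hU : I * (y : ℂ) ∈ upperHalf := I_mul_mem_upperHalf (by linarith)
    have hne : I * (y : ℂ) ≠ w := by
      intro h
      have := congrArg im h
      simp at this
      linarith
    refine (norm_kernel_div_le hne (hE.norm_starFn_div_le hU)).trans (le_trans ?_ h1)
    refine div_le_self (norm_nonneg _) ?_
    have h3 := abs_im_le_norm ((w : ℂ) - I * y)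
    simp only [sub_im, ofReal_im, mul_im, I_re, I_im, ofReal_re, zero_mul, one_mul, zero_add,
      zero_sub, abs_neg] at h3
    exact h2.trans ((le_abs_self y).trans h3)
  exact ⟨differentiable_kernel hE.entire w, integrable_sq_kernel_div hE w,
    isBoundedType_kernel_div hE w, hmt,
    by rw [show (fun z => kernel E w z) = kernel E w from rfl, starFn_kernel hE.entire]
       exact isBoundedType_kernel_div hE w,
    by rw [show (fun z => kernel E w z) = kernel E w from rfl, starFn_kernel hE.entire]
       exact hmt⟩

/-! ### The reproducing formula at real points. -/

theorem innerH_integrand_eq (E f g : ℂ → ℂ) (t : ℝ) :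
    f t * conj (g t) / ((‖E t‖ ^ 2 : ℝ) : ℂ) = f t / E t * conj (g t / E t) := by
  rw [map_div₀, div_mul_div_comm, mul_conj', ofReal_pow]

theorem integrable_innerH_integrand {E f g : ℂ → ℂ} (hE : IsHermiteBiehler E) (hf : MemH E f)
    (hg : MemH E g) : Integrable fun t : ℝ => f t * conj (g t) / ((‖E t‖ ^ 2 : ℝ) : ℂ) := by
  simp only [innerH_integrand_eq]
  exact (hf.memLp hE).integrable_mul (hg.memLp hE).star

theorem tendsto_vertical (w : ℝ) :
    Tendsto (fun ε : ℝ => (w : ℂ) + ε * I) (𝓝[>] 0) (𝓝 (w : ℂ)) := by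
  have h : Continuous fun ε : ℝ => (w : ℂ) + ε * I := by fun_prop
  have h1 := h.tendsto 0
  simp only [ofReal_zero, zero_mul, add_zero] at h1
  exact h1.mono_left nhdsWithin_le_nhds

/-- The value at a real point is reproduced by the kernel. -/
theorem MemH.innerH_kernel {E f : ℂ → ℂ} (hE : IsHermiteBiehler E) (hf : MemH E f) (w : ℝ) :
    innerH E f (kernel E w) = f w := by
  rcases eq_or_ne (E w) 0 with h0 | h0
  · rw [hf.eq_zero_of_real_zero hE h0, innerH]
    simp [kernel_of_eq_zero h0]
  set g : ℝ → ℂ := fun t => f t / E t with hg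
  set k : ℝ → ℂ := fun t => starFn f t / E t with hk
  set N : ℝ → ℂ := fun t => conj (E w) * conj (k t) - E w * g t with hN
  have hfs := hf.star
  have hgL : MemLp g 2 volume := hf.memLp hE
  have hkL : MemLp k 2 volume := hfs.memLp hE
  have hne : ∀ᵐ t : ℝ, t ≠ w := by simp [ae_iff, measure_singleton]
  -- On the real line `conj k = f / conj E`, so the integrand splits into boundary values of `f / E`
  -- and conjugate boundary values of `f* / E`.
  have hcongr : (fun t : ℝ => f t * conj (kernel E w t) / ((‖E t‖ ^ 2 : ℝ) : ℂ)) =ᵐ[volume]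
      fun t => (2 * Real.pi * I)⁻¹ * (N t / (w - t)) := by
    filter_upwards [hE.ae_ne_zero, hne] with t ht htw
    have htw' : (t : ℂ) ≠ w := by exact_mod_cast htw
    have h1 : (w : ℂ) - t ≠ 0 := sub_ne_zero.2 htw'.symm
    have h2 : conj (E t) ≠ 0 := by simpa using ht
    have h3 : (Real.pi : ℂ) ≠ 0 := by exact_mod_cast Real.pi_ne_zero
    rw [ofReal_pow, ← mul_conj', kernel_of_ne E htw']
    simp only [hN, hg, hk, starFn_ofReal, map_div₀, map_sub, map_mul, conj_conj, conj_ofReal,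
      conj_I, map_ofNat]
    field_simp
    ring
  have hNi : Integrable fun t => N t / (w - t) := by
    have h1 := (integrable_innerH_integrand hE hf (memH_kernel hE w)).congr hcongr
    have h2 := h1.const_mul (2 * Real.pi * I)
    refine h2.congr (Eventually.of_forall fun t => ?_)
    simp only
    rw [mul_inv_cancel_left₀ two_pi_I_ne_zero]
  have hmain : ∫ t, N t / (w - t) = 2 * Real.pi * I * f w := by
    -- The two parts of `N / (w - t)` need not be separately integrable at `w`. A real factor
    -- between `0` and `1` regularizes both, and dominated convergence removes it.
    have hlim : Tendsto (fun ε : ℝ =>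
        ∫ t, N t / (w - t) * (((w - t) ^ 2 / ((w - t) ^ 2 + ε ^ 2) : ℝ)))
        (𝓝[>] 0) (𝓝 (∫ t, N t / (w - t))) := by
      refine tendsto_integral_filter_of_dominated_convergence (fun t => ‖N t / (w - t)‖) ?_ ?_
        hNi.norm ?_
      · refine Eventually.of_forall fun ε => hNi.1.mul ?_
        refine (Measurable.complex_ofReal ?_).aestronglyMeasurable
        fun_prop
      · refine Eventually.of_forall fun ε => Eventually.of_forall fun t => ?_
        rw [norm_mul, norm_real, Real.norm_of_nonneg (by positivity)]
        refine mul_le_of_le_one_right (norm_nonneg _) (div_le_one_of_le₀ ?_ (by positivity))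
        linarith [sq_nonneg ε]
      · filter_upwards [hne] with t ht
        have h1 : (w - t) ^ 2 ≠ 0 := pow_ne_zero 2 (sub_ne_zero.2 ht.symm)
        have h2 : ContinuousAt (fun ε : ℝ => N t / (w - t) *
            (((w - t) ^ 2 / ((w - t) ^ 2 + ε ^ 2) : ℝ) : ℂ)) 0 := by
          refine continuousAt_const.mul (continuous_ofReal.continuousAt.comp ?_)
          refine continuousAt_const.div (by fun_prop) ?_
          simpa using h1
        have h3 := h2.tendsto
        rw [zero_pow two_ne_zero, add_zero, div_self h1, ofReal_one, mul_one] at h3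
        exact h3.mono_left nhdsWithin_le_nhds
    have hval : ∀ ε > 0,
        ∫ t, N t / (w - t) * (((w - t) ^ 2 / ((w - t) ^ 2 + ε ^ 2) : ℝ)) =
          Real.pi * I * (conj (E w * (starFn f (w + ε * I) / E (w + ε * I))) +
            E w * (f (w + ε * I) / E (w + ε * I))) := by
      intro ε hε
      set c : ℂ := w + ε * I with hc
      have hcU : c ∈ upperHalf := by simpa [upperHalf, hc] using hε
      have hci : c.im ≠ 0 := ne_of_gt hcU
      have hci' : (conj c).im ≠ 0 := by simpa using hci
      have hcc : conj c = w - ε * I := by simp [hc, sub_eq_add_neg]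
      obtain ⟨a1, a2⟩ := hf.cauchy hE hcU
      obtain ⟨b1, b2⟩ := hfs.cauchy hE hcU
      have hconj : ∀ d : ℂ, ∫ t : ℝ, conj (k t) / (t - d) =
          conj (∫ t : ℝ, k t / (t - conj d)) := by
        intro d
        rw [← integral_conj]
        refine integral_congr_ae (Eventually.of_forall fun t => ?_)
        simp
      have i1 := integrable_div_sub hgL hci
      have i2 := integrable_div_sub hgL hci'
      have i3 : Integrable fun t : ℝ => conj (k t) / (t - c) := integrable_div_sub hkL.star hci
      have i4 : Integrable fun t : ℝ => conj (k t) / (t - conj c) :=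
        integrable_div_sub hkL.star hci'
      have j1 : Integrable fun t : ℝ =>
          -(conj (E w) / 2) * (conj (k t) / (t - c) + conj (k t) / (t - conj c)) :=
        (i3.add i4).const_mul _
      have j2 : Integrable fun t : ℝ => E w / 2 * (g t / (t - c) + g t / (t - conj c)) :=
        (i1.add i2).const_mul _
      -- The regularized kernel `(w - t) / ((w - t)² + ε²)` is minus half the sum of the Cauchy
      -- kernels at `c` and `conj c`. Cauchy's formulas keep the pole `c` for `g` and the pole `conj
      -- c` for `conj k`.
      have hpt : ∀ t : ℝ, N t / (w - t) * (((w - t) ^ 2 / ((w - t) ^ 2 + ε ^ 2) : ℝ)) =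
          (-(conj (E w) / 2)) * (conj (k t) / (t - c) + conj (k t) / (t - conj c)) +
            (E w / 2) * (g t / (t - c) + g t / (t - conj c)) := by
        intro t
        have h1 := ofReal_sub_ne_zero hci t
        have h2 := ofReal_sub_ne_zero hci' t
        have h3 : ((w : ℂ) - t) ^ 2 + ε ^ 2 = (t - c) * (t - conj c) := by
          rw [hcc, hc]
          linear_combination (ε : ℂ) ^ 2 * I_sq
        have h4 : N t / (w - t) * (w - t) ^ 2 = N t * (w - t) := by
          rcases eq_or_ne ((w : ℂ) - t) 0 with h | h
          · simp [h]
          · field_simp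
        have h5 : ((t : ℂ) - c) + (t - conj c) = -2 * (w - t) := by
          rw [hcc, hc]
          ring
        push_cast
        rw [h3, ← mul_div_assoc, h4]
        simp only [hN]
        field_simp
        linear_combination (conj (E w) * conj (k t) - E w * g t) * h5
      simp only [hpt]
      rw [integral_add j1 j2, integral_const_mul, integral_const_mul, integral_add i3 i4,
        integral_add i1 i2]
      have e3 : ∫ t : ℝ, conj (k t) / (t - c) = 0 := by rw [hconj, b2, map_zero]
      have e4 : ∫ t : ℝ, conj (k t) / (t - conj c) =
          conj (2 * Real.pi * I * (starFn f c / E c)) := by rw [hconj, conj_conj, b1]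
      simp only [hg] at a1 a2 ⊢
      rw [a1, a2]
      rw [e3, e4]
      simp only [map_mul, conj_I, conj_ofReal, map_ofNat]
      ring
    have hlim2 : Tendsto (fun ε : ℝ => Real.pi * I *
        (conj (E w * (starFn f (w + ε * I) / E (w + ε * I))) +
            E w * (f (w + ε * I) / E (w + ε * I)))) (𝓝[>] 0)
        (𝓝 (Real.pi * I * (conj (E w * (starFn f w / E w)) + E w * (f w / E w)))) := by
      have hEt := (hE.entire.continuous.tendsto (w : ℂ)).comp (tendsto_vertical w)
      have hft := (hf.entire.continuous.tendsto (w : ℂ)).comp (tendsto_vertical w)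
      have hst := (hfs.entire.continuous.tendsto (w : ℂ)).comp (tendsto_vertical w)
      refine Tendsto.const_mul _ (Tendsto.add ?_ ((hft.div hEt h0).const_mul _))
      exact (continuous_conj.tendsto _).comp ((hst.div hEt h0).const_mul _)
    have h1 := tendsto_nhds_unique hlim (hlim2.congr'
      (eventually_nhdsWithin_of_forall fun ε hε => (hval ε hε).symm))
    rw [h1, mul_div_cancel₀ _ h0, mul_div_cancel₀ _ h0, starFn_ofReal, conj_conj]
    ring
  rw [innerH, integral_congr_ae hcongr, integral_const_mul, hmain,
    inv_mul_cancel_left₀ two_pi_I_ne_zero]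

/-! ### `H(E)` inside `L²`, and bounded point evaluations. -/

open Classical in
/-- The class of `f / E` in `L²(ℝ)`; zero if `f / E` is not square integrable. -/
def toL2 (E f : ℂ → ℂ) : Lp ℂ 2 (volume : Measure ℝ) :=
  if h : MemLp (fun t : ℝ => f t / E t) 2 volume then h.toLp _ else 0

theorem coeFn_toL2 {E f : ℂ → ℂ} (hE : IsHermiteBiehler E) (hf : MemH E f) :
    toL2 E f =ᵐ[volume] fun t : ℝ => f t / E t := by
  rw [toL2, dif_pos (hf.memLp hE)]
  exact (hf.memLp hE).coeFn_toLp

theorem inner_toL2 {E f g : ℂ → ℂ} (hE : IsHermiteBiehler E) (hf : MemH E f) (hg : MemH E g) :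
    inner ℂ (toL2 E g) (toL2 E f) = innerH E f g := by
  rw [L2.inner_def, innerH]
  refine integral_congr_ae ?_
  filter_upwards [coeFn_toL2 hE hf, coeFn_toL2 hE hg] with t h1 h2
  rw [h1, h2, innerH_integrand_eq, RCLike.inner_apply]

theorem norm_toL2 {E f : ℂ → ℂ} (hE : IsHermiteBiehler E) (hf : MemH E f) :
    ‖toL2 E f‖ = normH E f := by
  have h := inner_toL2 hE hf hf
  have h1 : innerH E f f = ((normH E f ^ 2 : ℝ) : ℂ) := by
    rw [normH_sq, innerH, ← integral_complex_ofReal]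
    refine integral_congr_ae (Eventually.of_forall fun t => ?_)
    simp only [innerH_integrand_eq]
    rw [mul_conj', ofReal_pow]
  rw [h1, inner_self_eq_norm_sq_to_K] at h
  have h2 : ‖toL2 E f‖ ^ 2 = normH E f ^ 2 := ofReal_injective (by simpa using h)
  exact (sq_eq_sq₀ (norm_nonneg _) (normH_nonneg _ _)).1 h2

theorem toL2_add_const_mul {E f g : ℂ → ℂ} (hE : IsHermiteBiehler E) (hf : MemH E f)
    (hg : MemH E g) (c : ℂ) :
    toL2 E (fun z => f z + c * g z) = toL2 E f + c • toL2 E g := by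
  refine Lp.ext ?_
  filter_upwards [coeFn_toL2 hE (hf.add hE (hg.const_mul hE c)), coeFn_toL2 hE hf,
    coeFn_toL2 hE hg, Lp.coeFn_add (toL2 E f) (c • toL2 E g), Lp.coeFn_smul c (toL2 E g)]
    with t h1 h2 h3 h4 h5
  rw [h1, h4, Pi.add_apply, h5, Pi.smul_apply, h2, h3, smul_eq_mul]
  ring

theorem toL2_sub_sum {E f : ℂ → ℂ} (hE : IsHermiteBiehler E) (hf : MemH E f) {ι : Type*}
    (s : Finset ι) (c : ι → ℂ) {u : ι → ℂ → ℂ} (hu : ∀ n, MemH E (u n)) :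
    toL2 E (fun z => f z - ∑ n ∈ s, c n * u n z) = toL2 E f - ∑ n ∈ s, c n • toL2 E (u n) := by
  classical
  induction s using Finset.induction_on with
  | empty => simp
  | insert n s hn ih =>
    have h := toL2_add_const_mul hE (hf.sub_sum hE s fun m => (hu m).const_mul hE (c m)) (hu n)
      (-c n)
    rw [ih] at h
    rw [Finset.sum_insert hn, sub_add_eq_sub_sub_swap, sub_eq_add_neg (_ - _), ← neg_smul, ← h]
    congr 1
    funext z
    rw [Finset.sum_insert hn]
    ring

/-- Multiplication by `F` embeds `H(E)` isometrically into `H(EF)`. -/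
theorem toL2_mul_left {E F f : ℂ → ℂ} (hE : IsHermiteBiehler E) (hF : IsHermiteBiehler F)
    (hf : MemH E f) : toL2 (fun z => E z * F z) (fun z => F z * f z) = toL2 E f := by
  refine Lp.ext ?_
  filter_upwards [coeFn_toL2 (hE.mul hF) (hf.mul_left hF), coeFn_toL2 hE hf, hF.ae_ne_zero]
    with t h1 h2 h3
  rw [h1, h2, mul_comm (F t), mul_div_mul_right _ _ h3]

theorem innerH_const_mul_right (E f g : ℂ → ℂ) (c : ℂ) :
    innerH E f (fun z => c * g z) = conj c * innerH E f g := by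
  rw [innerH, innerH, ← integral_const_mul]
  refine integral_congr_ae (Eventually.of_forall fun t => ?_)
  simp only [map_mul]
  ring

/-- Point evaluations are bounded on `H(E)`. -/
theorem exists_norm_apply_le {E : ℂ → ℂ} (hE : IsHermiteBiehler E) (z : ℂ) :
    ∃ C : ℝ, ∀ f, MemH E f → ‖f z‖ ≤ C * normH E f := by
  rcases lt_trichotomy z.im 0 with hz | hz | hz
  · have hz' : conj z ∈ upperHalf := by simpa [upperHalf] using hz
    refine ⟨‖E (conj z)‖ * (conj z).im ^ (-(1 / 2) : ℝ), fun f hf => ?_⟩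
    have h := hf.star.norm_le_of_mem_upperHalf hE hz'
    rw [normH_starFn, starFn, conj_conj, norm_conj] at h
    exact h
  · have hz' : z = (z.re : ℂ) := Complex.ext rfl (by simpa using hz)
    rw [hz']
    refine ⟨normH E (kernel E z.re), fun f hf => ?_⟩
    have hk := memH_kernel hE z.re
    rw [← hf.innerH_kernel hE, ← inner_toL2 hE hf hk, ← norm_toL2 hE hf, ← norm_toL2 hE hk]
    exact norm_inner_le_norm _ _
  · exact ⟨_, fun f hf => hf.norm_le_of_mem_upperHalf hE hz⟩

/-! ### Orthogonal kernels and the sampling expansions. -/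

/-- The kernels at distinct real points with congruent phases are orthogonal. -/
theorem kernel_eq_zero_of_phase {E : ℂ → ℂ} {φ : ℝ → ℝ} (hφ : IsPhaseFunction E φ) {x y : ℝ}
    (hxy : x ≠ y) {k : ℤ} (h : φ x = φ y + k * Real.pi) : kernel E x y = 0 := by
  have hyx : (y : ℂ) ≠ x := by exact_mod_cast hxy.symm
  -- Reality of `E e^{iφ}` makes `conj E` equal to `E e^{2iφ}`, also at zeros of `E`. Phases
  -- congruent modulo `π` give the same `e^{2iφ}`, and the kernel's numerator cancels.
  have key : ∀ t : ℝ, conj (E t) = E t * exp (I * φ t) ^ 2 := by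
    intro t
    have h1 := conj_eq_iff_im.2 (hφ.real t)
    have h2 : conj (exp (I * φ t)) = (exp (I * φ t))⁻¹ := by
      rw [← exp_conj, ← exp_neg]
      simp
    rw [map_mul, h2, mul_inv_eq_iff_eq_mul₀ (exp_ne_zero _)] at h1
    rw [h1]
    ring
  have hexp : exp (I * φ x) ^ 2 = exp (I * φ y) ^ 2 := by
    rw [← exp_nat_mul, ← exp_nat_mul, exp_eq_exp_iff_exists_int]
    refine ⟨k, ?_⟩
    rw [h]
    push_cast
    ring
  rw [kernel_of_ne E hyx, starFn_ofReal, key x, key y, hexp]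
  simp only [div_eq_zero_iff]
  left
  ring

section Expansion

variable {ι : Type*} {E F : ℂ → ℂ} {lam : ι → ℝ}

/-- The class of `f / E` is also the class of `Ff / EF`, so the reproducing formula of `H(EF)`
applies to `Ff`. -/
theorem inner_kernel_mul_left (hE : IsHermiteBiehler E) (hF : IsHermiteBiehler F) {f : ℂ → ℂ}
    (hf : MemH E f) (w : ℝ) :
    inner ℂ (toL2 (fun z => E z * F z) (kernel (fun z => E z * F z) w)) (toL2 E f) =
      F w * f w := by
  rw [← toL2_mul_left hE hF hf, inner_toL2 (hE.mul hF) (hf.mul_left hF) (memH_kernel (hE.mul hF) w),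
    (hf.mul_left hF).innerH_kernel (hE.mul hF) w]

/-- The kernel reproduces itself. Diagonal values are therefore real and nonnegative, and taking
real parts under the square root loses nothing; a zero diagonal value means a zero vector. -/
theorem kernel_self {E : ℂ → ℂ} (hE : IsHermiteBiehler E) (w : ℝ) :
    kernel E w w = ((‖toL2 E (kernel E w)‖ ^ 2 : ℝ) : ℂ) := by
  have hk := memH_kernel hE w
  rw [← hk.innerH_kernel hE w, ← inner_toL2 hE hk hk, inner_self_eq_norm_sq_to_K]
  norm_cast

theorem hasSum_kernel_expansion (hE : IsHermiteBiehler E) (hF : IsHermiteBiehler F)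
    (horth : Pairwise fun m n => kernel (fun z => E z * F z) (lam m) (lam n) = 0)
    (hc : IsCompleteIn (fun z => E z * F z) fun n z => kernel (fun z => E z * F z) (lam n) z)
    {f : ℂ → ℂ} (hf : MemH E f) :
    HasSum (fun n => (F (lam n) * f (lam n) / kernel (fun z => E z * F z) (lam n) (lam n)) •
      toL2 (fun z => E z * F z) (kernel (fun z => E z * F z) (lam n))) (toL2 E f) := by
  have hEF := hE.mul hF
  have hk : ∀ n, MemH (fun z => E z * F z) (kernel (fun z => E z * F z) (lam n)) := fun n =>
    memH_kernel hEF (lam n)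
  have h := hasSum_orthogonal_expansion
    (fun n => toL2 (fun z => E z * F z) (kernel (fun z => E z * F z) (lam n)))
    (fun m n hmn => by
      beta_reduce
      rw [inner_toL2 hEF (hk n) (hk m), (hk n).innerH_kernel hEF, horth hmn.symm]) (toL2 E f) ?_
  · simpa only [inner_kernel_mul_left hE hF hf, ← kernel_self hEF] using h
  · intro ε hε
    obtain ⟨s, c, hs⟩ := hc _ (hf.mul_left hF) ε hε
    refine ⟨s, c, ?_⟩
    rw [← toL2_mul_left hE hF hf, ← toL2_sub_sum hEF (hf.mul_left hF) s c hk, norm_toL2 hEF]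
    · exact hs
    · exact (hf.mul_left hF).sub_sum hEF s fun n => (hk n).const_mul hEF (c n)

/-- Pairing the expansion of `Ff` with itself gives the frame identity. Only `‖a n‖` enters, so both
the conjugated and the unconjugated coefficients of the theorem are covered. -/
theorem isParsevalFrame_kernel (hE : IsHermiteBiehler E) (hF : IsHermiteBiehler F)
    (horth : Pairwise fun m n => kernel (fun z => E z * F z) (lam m) (lam n) = 0)
    (hc : IsCompleteIn (fun z => E z * F z) fun n z => kernel (fun z => E z * F z) (lam n) z)
    (a : ι → ℂ) (ha : ∀ n, ‖a n‖ = ‖F (lam n)‖) :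
    IsParsevalFrame E fun n z => a n * kernel E (lam n) z /
      (Real.sqrt (kernel (fun z => E z * F z) (lam n) (lam n)).re : ℂ) := by
  have hEF := hE.mul hF
  simp only [mul_div_right_comm]
  refine ⟨fun n => (memH_kernel hE _).const_mul hE _, fun f hf => ?_⟩
  have h := ((hasSum_kernel_expansion hE hF horth hc hf).mapL (innerSL ℂ (toL2 E f))).mapL reCLM
  simp only [innerSL_apply_apply, inner_smul_right, inner_self_eq_norm_sq_to_K, reCLM_apply] at h
  have h1 : (((‖toL2 E f‖ : ℂ)) ^ 2).re = normH E f ^ 2 := by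
    rw [norm_toL2 hE hf]
    norm_cast
  rw [← h1]
  refine h.congr_fun fun n => ?_
  rw [← inner_conj_symm, inner_kernel_mul_left hE hF hf, innerH_const_mul_right]
  have hval : innerH E f (fun z => kernel E (lam n) z) = f (lam n) := hf.innerH_kernel hE _
  rw [hval, kernel_self hEF, ofReal_re, Real.sqrt_sq (norm_nonneg _), div_mul_eq_mul_div, mul_conj',
    norm_mul, norm_conj, norm_div, ha, norm_mul, norm_real, norm_norm, ← ofReal_pow, ← ofReal_div, ofReal_re]
  ring

/-- The series is the orthogonal projection to `H(E)` of the expansion of `Ff`. Its remainders are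
thus no larger than those of the orthogonal expansion. -/
theorem isExpansion_kernel (hE : IsHermiteBiehler E) (hF : IsHermiteBiehler F)
    (horth : Pairwise fun m n => kernel (fun z => E z * F z) (lam m) (lam n) = 0)
    (hc : IsCompleteIn (fun z => E z * F z) fun n z => kernel (fun z => E z * F z) (lam n) z)
    {f : ℂ → ℂ} (hf : MemH E f) :
    IsExpansion E f fun n z => f (lam n) * ((‖F (lam n)‖ ^ 2 : ℝ) * kernel E (lam n) z /
      kernel (fun z => E z * F z) (lam n) (lam n)) := by
  have hEF := hE.mul hF
  set κ : ι → ℝ := fun n =>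
    ‖toL2 (fun z => E z * F z) (kernel (fun z => E z * F z) (lam n))‖ ^ 2 with hκ
  set d : ι → ℂ := fun n => f (lam n) * (‖F (lam n)‖ ^ 2 : ℝ) / κ n with hd
  have hterm : (fun n z => f (lam n) * ((‖F (lam n)‖ ^ 2 : ℝ) * kernel E (lam n) z /
      kernel (fun z => E z * F z) (lam n) (lam n))) = fun n z => d n * kernel E (lam n) z := by
    funext n z
    rw [kernel_self hEF]
    simp only [hd, hκ]
    ring
  rw [hterm]
  have hk := fun n => memH_kernel hE (lam n)
  have hg : ∀ s : Finset ι, MemH E fun z => f z - ∑ n ∈ s, d n * kernel E (lam n) z := fun s =>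
    hf.sub_sum hE s fun n => (hk n).const_mul hE (d n)
  have hsum := hasSum_kernel_expansion hE hF horth hc hf
  have hle : ∀ s : Finset ι, normH E (fun z => f z - ∑ n ∈ s, d n * kernel E (lam n) z) ≤
      ‖toL2 E f - ∑ n ∈ s, (F (lam n) * f (lam n) / kernel (fun z => E z * F z) (lam n) (lam n)) •
        toL2 (fun z => E z * F z) (kernel (fun z => E z * F z) (lam n))‖ := by
    intro s
    rw [← norm_toL2 hE (hg s)]
    set x := toL2 E fun z => f z - ∑ n ∈ s, d n * kernel E (lam n) z with hx
    set y := toL2 E f - ∑ n ∈ s, (F (lam n) * f (lam n) /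
      kernel (fun z => E z * F z) (lam n) (lam n)) •
        toL2 (fun z => E z * F z) (kernel (fun z => E z * F z) (lam n)) with hy
    -- This says that `x - y` is orthogonal to `x`: the remainder `x` comes from `H(E)`, and the two
    -- kernels reproduce the same multiple of its value at `lam n`. Cauchy-Schwarz then gives `‖x‖ ≤
    -- ‖y‖` with no projection operator.
    have h1 : inner ℂ x x = inner ℂ x y := by
      have h2 : x = toL2 E f - ∑ n ∈ s, d n • toL2 E (kernel E (lam n)) :=
        toL2_sub_sum hE hf s d hk
      nth_rw 2 [h2]
      rw [hy, inner_sub_right, inner_sub_right, inner_sum, inner_sum]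
      congr 1
      refine Finset.sum_congr rfl fun n _ => ?_
      rw [inner_smul_right, inner_smul_right, ← inner_conj_symm, ← inner_conj_symm x (toL2 _ _), hx,
        inner_kernel_mul_left hE hF (hg s), inner_toL2 hE (hg s) (hk n),
        (hg s).innerH_kernel hE, kernel_self hEF]
      simp only [hd, hκ, map_mul, ofReal_pow, ← mul_conj']
      ring
    have h3 : ‖x‖ * ‖x‖ ≤ ‖x‖ * ‖y‖ := by
      have h4 := norm_inner_le_norm (𝕜 := ℂ) x y
      rw [← h1, inner_self_eq_norm_sq_to_K] at h4
      rw [← sq]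
      simpa using h4
    rcases (norm_nonneg x).eq_or_lt with h0 | h0
    · rw [← h0]
      exact norm_nonneg _
    · exact le_of_mul_le_mul_left h3 h0
  have hnorm : Tendsto (fun s : Finset ι =>
      normH E fun z => f z - ∑ n ∈ s, d n * kernel E (lam n) z) atTop (𝓝 0) := by
    refine squeeze_zero (fun s => normH_nonneg _ _) hle ?_
    have h := (tendsto_const_nhds (x := toL2 E f)).sub hsum
    rw [sub_self] at h
    simpa using h.norm
  refine ⟨hnorm, fun z => ?_⟩
  obtain ⟨C, hC⟩ := exists_norm_apply_le hE z
  refine tendsto_iff_norm_sub_tendsto_zero.2 ?_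
  refine squeeze_zero (fun s => norm_nonneg _) (fun s => ?_)
    (by simpa using hnorm.const_mul C)
  rw [norm_sub_rev]
  exact hC _ (hg s)

end Expansion

end

end DeBranges

open DeBranges Complex in
open scoped ComplexConjugate in
theorem theoremT (E F : ℂ → ℂ) (hE : IsHermiteBiehler E) (hF : IsHermiteBiehler F)
    (φ : ℝ → ℝ) (hφ : IsPhaseFunction (fun z => E z * F z) φ)
    (α : ℝ) (hα : α ∈ Set.Ico 0 Real.pi)
    (J : Set ℤ) (lam : J → ℝ) (hlam : ∀ n : J, φ (lam n) = ((n : ℤ) : ℝ) * Real.pi + α)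
    (hcomplete : IsCompleteIn (fun z => E z * F z)
      (fun (n : J) z => kernel (fun z => E z * F z) (lam n) z)) :
    IsParsevalFrame E (fun (n : J) z =>
        conj (F (lam n)) * kernel E (lam n) z /
          (Real.sqrt (kernel (fun z => E z * F z) (lam n) (lam n)).re : ℂ)) ∧
      (∀ f, MemH E f → IsExpansion E f (fun (n : J) z =>
        f (lam n) * ((‖F (lam n)‖ ^ 2 : ℝ) * kernel E (lam n) z /
          kernel (fun z => E z * F z) (lam n) (lam n)))) ∧
      IsParsevalFrame F (fun (n : J) z =>
        E (lam n) * kernel F (lam n) z /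
          (Real.sqrt (kernel (fun z => E z * F z) (lam n) (lam n)).re : ℂ)) ∧
      (∀ g, MemH F g → IsExpansion F g (fun (n : J) z =>
        g (lam n) * ((‖E (lam n)‖ ^ 2 : ℝ) * kernel F (lam n) z /
          kernel (fun z => E z * F z) (lam n) (lam n)))) := by
  have horth : Pairwise fun m n : J =>
      kernel (fun z => E z * F z) (lam m) (lam n) = 0 := by
    intro m n hmn
    refine kernel_eq_zero_of_phase hφ (fun h => hmn ?_) (k := (m : ℤ) - n) ?_
    · have h1 := hlam m
      rw [h, hlam n, add_left_inj, mul_left_inj' Real.pi_ne_zero] at h1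
      exact Subtype.ext (by exact_mod_cast h1.symm)
    · rw [hlam m, hlam n]
      push_cast
      ring
  refine ⟨isParsevalFrame_kernel hE hF horth hcomplete _ fun n => norm_conj _,
    fun f hf => isExpansion_kernel hE hF horth hcomplete hf, ?_⟩
  -- Orthogonality and completeness depend only on the product, so the roles of `E` and `F` can be
  -- exchanged.
  have hcomm : (fun z => E z * F z) = fun z => F z * E z := funext fun z => mul_comm _ _
  rw [hcomm] at horth hcomplete ⊢
  exact ⟨isParsevalFrame_kernel hF hE horth hcomplete _ fun n => rfl,
    fun g hg => isExpansion_kernel hF hE horth hcomplete hg⟩
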